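/- Let $n\ge 1$. Throughout, functions are real-valued and $L^2=L^2(\mathbb R^n)$. For a bounded measurable set $Q$ of positive measure and a locally integrable $f$ put $$\mathrm{osc}_Q(f)=\frac1{|Q|}\int_Q\Big|f-\frac1{|Q|}\int_Q f\Big|.$$ A *dyadic cube* is a set $2^{-k}\big([0,1]^n+m+(-1)^k\alpha\big)$ with $k\in\mathbb Z$, $m\in\mathbb Z^n$, $\alpha\in\{0,\tfrac13\}^n$. A collection $\mathcal S$ of dyadic cubes is *$\eta$-sparse* if there are pairwise disjoint measurable sets $(E_Q)_{Q\in\mathcal S}$ with $E_Q\subset Q$ and $|E_Q|\ge\eta|Q|$ for all $Q\in\mathcal S$. A bounded linear operator $T$ on $L^2$ is a *Calderón–Zygmund operator* with kernel $K:\mathbb R^n\times\mathbb R^n\to\mathbb R$ if for some $\varepsilon>0$ and $A$ and all $x\ne y$, $$|K(x,y)|\le \frac{A}{|x-y|^{n}},\qquad |K(x+z,y)-K(x,y)|+|K(x,y+z)-K(x,y)|\le \frac{A|z|^\varepsilon}{|x-y|^{n+\varepsilon}}\quad\text{whenever } 2|z|<|x-y|,$$ and $Tf(x)=\int K(x,y)f(y)\,dy$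 for every compactly supported $f\in L^2$ and almost every $x\notin\operatorname{supp} f$. The function $T(1)\in\mathrm{BMO}$ is defined modulo constants: on each ball $B=B(x_0,r)$ it equals, up to an additive constant, $$T(\mathbf 1_{2B})(x)+\int_{(2B)^c}\big(K(x,y)-K(x_0,y)\big)\,dy,$$ where $2B=B(x_0,2r)$. Thus $T(1)=0$ in $\mathrm{BMO}$ means that on every ball $B$ this expression is almost everywhere equal to a constant (which may depend on $B$). **Proposition.** There is $\eta\in(0,1)$, depending only on $n$, such that the following holds. Let $T$ be a Calderón–Zygmund operator on $\mathbb R^n$ with $T(1)=0$ in $\mathrm{BMO}$. Then there is a constant $C<\infty$, depending on $T$ but not on $f$, such that for every $f\in L^2$ there is an $\eta$-sparse collection $\mathcal S$ of dyadic cubes with $$|Tf(x)|\le C\sum_{Q\in\mathcal S}\mathrm{osc}_Q(f)\,\mathbf 1_Q(x)\qquad\text{for almost every }x\in\mathbb R^n .$$ -/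

import Mathlib

open MeasureTheory
open scoped ENNReal NNReal

noncomputable section

namespace SparseOsc

/-- Euclidean space of dimension `n`, with Lebesgue measure `volume`. -/
abbrev E (n : ℕ) : Type := EuclideanSpace ℝ (Fin n)

/-- The real Hilbert space `L²(ℝⁿ)`. -/
abbrev L2 (n : ℕ) : Type := Lp ℝ 2 (volume : Measure (E n))

/-- The mean oscillation `⨍_Q |f - ⨍_Q f|`. -/
def osc {n : ℕ} (Q : Set (E n)) (f : E n → ℝ) : ℝ :=
  ⨍ x in Q, |f x - ⨍ y in Q, f y|

/-- The cube `2^{-k} ([0,1]^n + m + (-1)^k α)`. -/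
def dyadicCube {n : ℕ} (α : Fin n → ℝ) (k : ℤ) (m : Fin n → ℤ) : Set (E n) :=
  {x | ∀ i, (2 : ℝ) ^ (-k) * ((m i : ℝ) + (-1 : ℝ) ^ k * α i) ≤ x i ∧
    x i ≤ (2 : ℝ) ^ (-k) * ((m i : ℝ) + 1 + (-1 : ℝ) ^ k * α i)}

/-- The union, over all shifts `α ∈ {0, 1/3}^n`, of the shifted dyadic grids of `ℝⁿ`. -/
def dyadicCubes (n : ℕ) : Set (Set (E n)) :=
  {Q | ∃ α : Fin n → ℝ, (∀ i, α i = 0 ∨ α i = 1 / 3) ∧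
    ∃ (k : ℤ) (m : Fin n → ℤ), Q = dyadicCube α k m}

/-- `S` is an `η`-sparse collection of dyadic cubes: every `Q ∈ S` has a measurable part `F Q ⊆ Q`
of measure at least `η |Q|`, and these parts are pairwise disjoint. -/
def IsSparse {n : ℕ} (η : ℝ) (S : Set (Set (E n))) : Prop :=
  S ⊆ dyadicCubes n ∧
    ∃ F : Set (E n) → Set (E n),
      (∀ Q ∈ S, MeasurableSet (F Q) ∧ F Q ⊆ Q ∧ ENNReal.ofReal η * volume Q ≤ volume (F Q)) ∧
      S.PairwiseDisjoint F

/-- `K` is a standard kernel with regularity exponent `ε` and constant `A`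
(values of `K` on the diagonal are irrelevant). -/
structure IsStandardKernel {n : ℕ} (K : E n → E n → ℝ) (ε A : ℝ) : Prop where
  size : ∀ x y, x ≠ y → |K x y| ≤ A / ‖x - y‖ ^ n
  regularity : ∀ x y z, x ≠ y → 2 * ‖z‖ < ‖x - y‖ →
    |K (x + z) y - K x y| + |K x (y + z) - K x y| ≤ A * ‖z‖ ^ ε / ‖x - y‖ ^ ((n : ℝ) + ε)

/-- The bounded operator `T` on `L²` is a Calderón–Zygmund operator with kernel `K`: the kernel is
standard for some exponent `ε > 0`, and `T f (x) = ∫ K(x,y) f(y) dy` for every compactly supported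
`f ∈ L²` and almost every `x` outside the support of `f`. -/
structure IsCalderonZygmund {n : ℕ} (T : L2 n →L[ℝ] L2 n) (K : E n → E n → ℝ) : Prop where
  kernel : ∃ ε A : ℝ, 0 < ε ∧ IsStandardKernel K ε A
  assoc : ∀ (f : E n → ℝ) (hf : MemLp f 2 volume), HasCompactSupport f →
    ∀ᵐ x : E n, x ∉ tsupport f → T (hf.toLp f) x = ∫ y, K x y * f y

/-- `F` has bounded mean oscillation. -/
def MemBMO {n : ℕ} (F : E n → ℝ) : Prop :=
  LocallyIntegrable F ∧ ∃ M : ℝ, ∀ (x : E n) (r : ℝ), 0 < r → osc (Metric.ball x r) F ≤ M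

/-- `T b = F` in `BMO`, for a bounded function `b`. The operator is extended to `L^∞` in the usual
way: on each ball `B = B(x₀, r)`, up to an additive constant,
`T b (x) = T (b 1_{2B}) (x) + ∫_{(2B)ᶜ} (K(x,y) - K(x₀,y)) b(y) dy`. -/
def EqInBMO {n : ℕ} (T : L2 n →L[ℝ] L2 n) (K : E n → E n → ℝ) (b F : E n → ℝ) : Prop :=
  MemBMO F ∧ ∀ (x₀ : E n) (r : ℝ), 0 < r →
    ∃ g : L2 n, g =ᵐ[volume] (Metric.ball x₀ (2 * r)).indicator b ∧
      ∃ c : ℝ, ∀ᵐ x : E n, x ∈ Metric.ball x₀ r →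
        F x = T g x + (∫ y in (Metric.ball x₀ (2 * r))ᶜ, (K x y - K x₀ y) * b y) + c

/-- `∑_{Q ∈ S} osc_Q(f) 1_Q(x)`, a sum of nonnegative terms with value in `[0, ∞]`. -/
def sparseOscSum {n : ℕ} (S : Set (Set (E n))) (f : E n → ℝ) (x : E n) : ℝ≥0∞ :=
  ∑' Q : S, (Q : Set (E n)).indicator (fun _ => ENNReal.ofReal (osc (Q : Set (E n)) f)) x

end SparseOsc

end

/-!
The idea is to localize. For a cube `Q` let `Q.star` be a concentric ball of comparable size, and
let `localPart f Q` be `(f - c_Q) 1_{Q.star}`, where `c_Q` is the mean of `f` over `Q.star`. Its `L¹`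
norm is `|Q.star|` times an oscillation of `f` (`starOsc f Q`). If `P` is a small cube in `Q`, then
on `P`

`T (localPart f Q) = T (1_{P.starᶜ} localPart f Q) + T (localPart f P) + (c_P - c_Q) T 1_{P.star}`,

where `c_P` is the mean of `f` over `P.star`. The condition `T 1 = 0` says that `T 1_{P.star}` is
constant on `P` up to a bounded error, and by the `L²` bound the constant is bounded as well
(`exists_forall_enorm_op_indicator_ball_le`). So, as long as the averages of `localPart f Q` around
`P` and its contribution from outside `P.star` are at most a multiple of `starOsc f Q`, one may pass
from `Q` to `P` at the cost of one term `starOsc f Q` (`ae_enorm_op_localPart_le`).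

The weak type `(1,1)` bounds for `T` (`exists_mul_volume_op_le`, by the Calderón–Zygmund
decomposition) and for the maximal function (`mul_volume_maximal_le`) make this possible outside a
set of small measure: off a family of disjoint stopping cubes with total measure at most `|Q| / 4`,
the function `T (localPart f Q)` is itself at most a multiple of `starOsc f Q`, and each stopping
cube `P` is admissible in the above sense (`exists_stopping_cubes`). Iterating, the estimate
terminates almost everywhere, and the cubes selected on the way are sparse.

To obtain one sparse family for the whole space, all of this is done in the dyadic grid with shift
`(1/3, …, 1/3)`, in which the cubes containing the origin exhaust the space. Each of these cubes is
also made a stopping cube of its parent, so that the trees of selected cubes grow with the initial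
cube (`exists_stopping_rule`, `exists_sparse_top`). On these cubes `c_Q → 0`, so that `T (localPart
f Q)` tends to `T f` (`exists_sparse_cubes`). Finally `Q.star` is contained in a cube of one of the
shifted grids, of comparable size (`exists_dyadicCube_star_subset`).
-/

namespace SparseOsc

open Metric Set Filter Topology

/-! ### The dyadic grid with shift `1/3` -/

/-- The index of the cube of generation `k` containing `x`, in the dyadic grid with shift
`(1/3, …, 1/3)`. -/
noncomputable def cubeIdx {n : ℕ} (k : ℤ) (x : E n) : Fin n → ℤ :=
  fun i => ⌊(2 : ℝ) ^ k * x i - (-1 : ℝ) ^ k / 3⌋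

/-- Labels of the cubes of the grid with shift `(1/3, …, 1/3)`: generation and position. -/
abbrev Cube (n : ℕ) : Type := ℤ × (Fin n → ℤ)

namespace Cube

variable {n : ℕ}

/-- The half-open cube with label `Q`. Unlike the closed cubes, the half-open cubes of one
generation are genuinely disjoint. -/
def set (Q : Cube n) : Set (E n) := {x | cubeIdx Q.1 x = Q.2}

/-- The side length of a cube. -/
noncomputable def side (Q : Cube n) : ℝ := (2 : ℝ) ^ (-Q.1)

/-- The center of a cube. -/
noncomputable def center (Q : Cube n) : E n :=
  WithLp.toLp 2 fun i => Q.side * (Q.2 i + 1 / 2 + (-1 : ℝ) ^ Q.1 / 3)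

theorem side_pos (Q : Cube n) : 0 < Q.side := by unfold side; positivity

theorem mem_set {Q : Cube n} {x : E n} : x ∈ Q.set ↔ cubeIdx Q.1 x = Q.2 := Iff.rfl

theorem mem_set_iff {Q : Cube n} {x : E n} : x ∈ Q.set ↔
    ∀ i, Q.side * (Q.2 i + (-1 : ℝ) ^ Q.1 / 3) ≤ x i ∧
      x i < Q.side * (Q.2 i + (-1 : ℝ) ^ Q.1 / 3) + Q.side := by
  rw [mem_set, funext_iff]
  refine forall_congr' fun i => ?_
  have hp : (0 : ℝ) < (2 : ℝ) ^ Q.1 := by positivity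
  have hs : Q.side = ((2 : ℝ) ^ Q.1)⁻¹ := by rw [side, zpow_neg]
  rw [cubeIdx, Int.floor_eq_iff, hs]
  generalize (2 : ℝ) ^ Q.1 = p at *
  generalize (-1 : ℝ) ^ Q.1 = s at *
  constructor
  · rintro ⟨h1, h2⟩
    constructor
    · rw [inv_mul_le_iff₀ hp]; linarith
    · have : p⁻¹ * (Q.2 i + s / 3) + p⁻¹ = p⁻¹ * (Q.2 i + s / 3 + 1) := by ring
      rw [this, lt_inv_mul_iff₀ hp]; linarith
  · rintro ⟨h1, h2⟩
    have : p⁻¹ * (Q.2 i + s / 3) + p⁻¹ = p⁻¹ * (Q.2 i + s / 3 + 1) := by ring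
    rw [this, lt_inv_mul_iff₀ hp] at h2
    rw [inv_mul_le_iff₀ hp] at h1
    constructor <;> linarith

theorem center_mem (Q : Cube n) : Q.center ∈ Q.set := by
  rw [mem_set_iff]
  intro i
  have := Q.side_pos
  simp only [center]
  constructor <;> nlinarith

theorem set_eq_preimage (Q : Cube n) : Q.set = (WithLp.ofLp : E n → (Fin n → ℝ)) ⁻¹'
    (Set.pi univ fun i => Ico (Q.side * (Q.2 i + (-1 : ℝ) ^ Q.1 / 3))
      (Q.side * (Q.2 i + (-1 : ℝ) ^ Q.1 / 3) + Q.side)) := by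
  ext x
  simp [mem_set_iff]

theorem measurableSet_set (Q : Cube n) : MeasurableSet Q.set := by
  rw [set_eq_preimage]
  exact (PiLp.volume_preserving_ofLp (Fin n)).measurable
    (MeasurableSet.univ_pi fun i => measurableSet_Ico)

theorem volume_set (Q : Cube n) : volume Q.set = ENNReal.ofReal (Q.side ^ n) := by
  rw [set_eq_preimage, (PiLp.volume_preserving_ofLp (Fin n)).measure_preimage
    (MeasurableSet.univ_pi fun i => measurableSet_Ico).nullMeasurableSet, Real.volume_pi_Ico]
  simp [ENNReal.ofReal_pow Q.side_pos.le]

theorem volume_set_ne_top (Q : Cube n) : volume Q.set ≠ ∞ := by simp [volume_set]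

theorem volume_set_ne_zero (Q : Cube n) : volume Q.set ≠ 0 := by
  simpa [volume_set] using pow_pos Q.side_pos n

/-- The Euclidean norm is controlled by `n` times the maximum norm. -/
theorem _root_.SparseOsc.norm_le_of_forall_abs_le {x : E n} {a : ℝ} (h : ∀ i, |x i| ≤ a) :
    ‖x‖ ≤ n * a := by
  calc ‖x‖ = ‖∑ i, EuclideanSpace.single i (x i)‖ := by
        congr 1; ext j; simp
    _ ≤ ∑ i, ‖(EuclideanSpace.single i (x i) : E n)‖ := norm_sum_le _ _
    _ ≤ ∑ _i : Fin n, a := Finset.sum_le_sum fun i _ => by simpa using h i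
    _ = n * a := by simp

theorem norm_sub_center_le {Q : Cube n} {x : E n} (hx : x ∈ Q.set) :
    ‖x - Q.center‖ ≤ n * (Q.side / 2) := by
  refine norm_le_of_forall_abs_le fun i => ?_
  have h := mem_set_iff.1 hx i
  have := Q.side_pos
  simp only [PiLp.sub_apply, center]
  rw [abs_le]
  constructor <;> nlinarith

theorem _root_.SparseOsc.cubeIdx_eq_of_le {j k : ℤ} (hjk : j ≤ k) {x y : E n}
    (h : cubeIdx k x = cubeIdx k y) : cubeIdx j x = cubeIdx j y := by
  -- the shift alternates in sign so that consecutive generations are nested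
  have key : ∀ (k : ℤ) (x : E n) (i : Fin n), cubeIdx (k - 1) x i =
      (cubeIdx k x i + (if Even k then 1 else -1)) / 2 := by
    intro k x i
    have e : (2 : ℝ) ^ (k - 1) * x i - (-1 : ℝ) ^ (k - 1) / 3 =
        (((2 : ℝ) ^ k * x i - (-1 : ℝ) ^ k / 3) + ((if Even k then 1 else -1 : ℤ) : ℝ)) /
          (2 : ℕ) := by
      rw [zpow_sub_one₀ two_ne_zero, zpow_sub_one₀ (by norm_num)]
      split_ifs with hk
      · rw [hk.neg_one_zpow]; push_cast; ring
      · rw [(Int.not_even_iff_odd.1 hk).neg_one_zpow]; push_cast; ring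
    unfold cubeIdx
    rw [e, Int.floor_div_natCast, Int.floor_add_intCast]
    rfl
  induction j, hjk using Int.leInductionDown with
  | base => exact h
  | pred j _ ih => funext i; rw [key, key, ih]

theorem subset_of_mem {P Q : Cube n} (hk : Q.1 ≤ P.1) {x : E n} (hP : x ∈ P.set) (hQ : x ∈ Q.set) :
    P.set ⊆ Q.set := fun y hy => by
  rw [mem_set] at *
  rw [← hQ]
  exact cubeIdx_eq_of_le hk (hy.trans hP.symm)

theorem eq_of_mem {P Q : Cube n} (hk : Q.1 = P.1) {x : E n} (hP : x ∈ P.set) (hQ : x ∈ Q.set) :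
    P = Q := by
  rw [mem_set] at *
  exact Prod.ext hk.symm (by rw [← hP, ← hQ, hk])

/-- The cube of generation `k` containing `x`. -/
noncomputable def containing (k : ℤ) (x : E n) : Cube n := (k, cubeIdx k x)

theorem mem_containing (k : ℤ) (x : E n) : x ∈ (containing k x).set := rfl

theorem eq_containing {Q : Cube n} {x : E n} (h : x ∈ Q.set) : Q = containing Q.1 x :=
  eq_of_mem rfl h (mem_containing _ _)

/-- The dyadic parent of a cube. -/
noncomputable def parent (Q : Cube n) : Cube n := containing (Q.1 - 1) Q.center

theorem subset_parent (Q : Cube n) : Q.set ⊆ Q.parent.set :=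
  subset_of_mem (by simp [parent, containing]) Q.center_mem (mem_containing _ _)

theorem side_parent (Q : Cube n) : Q.parent.side = 2 * Q.side := by
  simp [side, parent, containing, zpow_sub₀, neg_sub, zpow_neg]; ring

theorem volume_parent (Q : Cube n) : volume Q.parent.set = 2 ^ n * volume Q.set := by
  rw [volume_set, volume_set, side_parent, mul_pow, ENNReal.ofReal_mul (by positivity)]
  simp

/-- The increasing chain of cubes of the grid that contain the origin. -/
noncomputable def top (N : ℕ) : Cube n := containing (-N) 0

theorem top_subset_top_succ (N : ℕ) : (top N : Cube n).set ⊆ (top (N + 1)).set :=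
  subset_of_mem (by simp [top, containing]) (mem_containing _ 0) (mem_containing _ 0)

theorem parent_top (N : ℕ) : (top N : Cube n).parent = top (N + 1) := by
  have h := subset_parent _ (mem_containing (-N : ℤ) (0 : E n))
  rw [top, eq_containing h]
  exact congrArg (fun k => containing k 0) (by simp [parent, containing]; ring)

theorem monotone_top : Monotone fun N => (top N : Cube n).set :=
  monotone_nat_of_le_succ top_subset_top_succ

/-- With shift `1/3`, the cubes around the origin exhaust the space: no point is ever cut off by a
coordinate hyperplane. -/
theorem exists_mem_top (x : E n) : ∃ N, x ∈ (top N : Cube n).set := by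
  obtain ⟨N, hN⟩ := pow_unbounded_of_one_lt (3 * ‖x‖) (one_lt_two (α := ℝ))
  refine ⟨N, ?_⟩
  rw [mem_set]
  funext i
  have hp : (0 : ℝ) < 2 ^ N := by positivity
  have hx : |(2 : ℝ) ^ (-(N : ℤ)) * x i| < 1 / 3 := by
    have h1 : |x i| ≤ ‖x‖ := by simpa using PiLp.norm_apply_le x i
    rw [abs_mul, zpow_neg, zpow_natCast, abs_of_pos (by positivity), inv_mul_lt_iff₀ hp]
    linarith
  rw [abs_lt] at hx
  simp only [top, containing, cubeIdx, PiLp.zero_apply, mul_zero, zero_sub]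
  rcases Int.even_or_odd (-(N : ℤ)) with h | h
  · rw [h.neg_one_zpow]
    have e1 : ⌊-((1 : ℝ) / 3)⌋ = -1 := by norm_num
    rw [e1, Int.floor_eq_iff]
    constructor <;> push_cast <;> linarith
  · rw [h.neg_one_zpow]
    have e1 : ⌊-((-1 : ℝ) / 3)⌋ = 0 := by norm_num
    rw [e1, Int.floor_eq_iff]
    constructor <;> push_cast <;> linarith

end Cube

variable {n : ℕ}

theorem dyadicCube_eq_preimage (α : Fin n → ℝ) (k : ℤ) (m : Fin n → ℤ) :
    dyadicCube α k m = (WithLp.ofLp : E n → (Fin n → ℝ)) ⁻¹'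
      (Set.Icc (fun i => (2 : ℝ) ^ (-k) * ((m i : ℝ) + (-1 : ℝ) ^ k * α i))
        (fun i => (2 : ℝ) ^ (-k) * ((m i : ℝ) + 1 + (-1 : ℝ) ^ k * α i))) := by
  ext x
  simp [dyadicCube, Pi.le_def, forall_and]

theorem volume_dyadicCube (α : Fin n → ℝ) (k : ℤ) (m : Fin n → ℤ) :
    volume (dyadicCube α k m) = ENNReal.ofReal (((2 : ℝ) ^ (-k)) ^ n) := by
  rw [dyadicCube_eq_preimage, (PiLp.volume_preserving_ofLp (Fin n)).measure_preimage
    measurableSet_Icc.nullMeasurableSet, Real.volume_Icc_pi]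
  have : ∀ i, (2 : ℝ) ^ (-k) * ((m i : ℝ) + 1 + (-1 : ℝ) ^ k * α i) -
      (2 : ℝ) ^ (-k) * ((m i : ℝ) + (-1 : ℝ) ^ k * α i) = (2 : ℝ) ^ (-k) := fun i => by ring
  simp only [this, Finset.prod_const, Finset.card_univ, Fintype.card_fin]
  rw [ENNReal.ofReal_pow (by positivity)]

/-- The endpoints of the two one-dimensional grids of generation `k` are `2⁻ᵏ / 3` apart, so a
shorter interval lies in a member of one of them. -/
theorem exists_shift {k : ℤ} {a r : ℝ} (hr : 2 * r < (2 : ℝ) ^ (-k) / 3) (hr0 : 0 ≤ r) :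
    ∃ α : ℝ, (α = 0 ∨ α = 1 / 3) ∧ ∃ m : ℤ, (2 : ℝ) ^ (-k) * (m + (-1 : ℝ) ^ k * α) ≤ a - r ∧
      a + r ≤ (2 : ℝ) ^ (-k) * (m + 1 + (-1 : ℝ) ^ k * α) := by
  have hp : (0 : ℝ) < (2 : ℝ) ^ (-k) := by positivity
  generalize (2 : ℝ) ^ (-k) = p at *
  obtain ⟨s, hs⟩ : ∃ s : ℤ, (-1 : ℝ) ^ k = s ∧ (s = 1 ∨ s = -1) := by
    rcases Int.even_or_odd k with h | h
    · exact ⟨1, by simp [h.neg_one_zpow]⟩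
    · exact ⟨-1, by simp [h.neg_one_zpow]⟩
  rw [hs.1]
  set u : ℝ := (a - r) / p
  have hu : a - r = p * u := by simp only [u]; field_simp
  set v : ℝ := 2 * r / p
  have hv : a + r = p * (u + v) := by simp only [u, v]; field_simp; ring
  have hv3 : v < 1 / 3 := by simp only [v]; rw [div_lt_iff₀ hp]; linarith
  have hv0 : 0 ≤ v := by positivity
  simp only [hu, hv, mul_le_mul_iff_right₀ hp]
  have f1 := Int.floor_le u
  have f2 := Int.lt_floor_add_one u
  by_cases h : u + v ≤ ⌊u⌋ + 1
  · exact ⟨0, Or.inl rfl, ⌊u⌋, by simpa using f1, by simpa using h⟩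
  · push Not at h
    rcases hs.2 with rfl | rfl
    · refine ⟨1 / 3, Or.inr rfl, ⌊u⌋, ?_, ?_⟩ <;> push_cast <;> linarith
    · refine ⟨1 / 3, Or.inr rfl, ⌊u⌋ + 1, ?_, ?_⟩ <;> push_cast <;> linarith

/-- Every ball lies in a dyadic cube of prescribed comparable size of one of the shifted grids. -/
theorem exists_closedBall_subset_dyadicCube {k : ℤ} (x : E n) {r : ℝ} (hr0 : 0 ≤ r)
    (hr : 2 * r < (2 : ℝ) ^ (-k) / 3) :
    ∃ α : Fin n → ℝ, (∀ i, α i = 0 ∨ α i = 1 / 3) ∧ ∃ m : Fin n → ℤ,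
      closedBall x r ⊆ dyadicCube α k m := by
  choose α hα m hm using fun i => exists_shift (a := x i) hr hr0
  refine ⟨α, hα, m, fun y hy i => ?_⟩
  have h1 : |y i - x i| ≤ r := by
    rw [mem_closedBall, dist_eq_norm] at hy
    exact (by simpa using PiLp.norm_apply_le (y - x) i : |y i - x i| ≤ _).trans hy
  rw [abs_le] at h1
  exact ⟨by linarith [(hm i).1], by linarith [(hm i).2]⟩

/-- The operator `T` acting on functions rather than on classes in `L²`; the value is `0` for
functions that are not square integrable. -/
noncomputable def op (T : L2 n →L[ℝ] L2 n) (h : E n → ℝ) : E n → ℝ :=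
  open Classical in if hm : MemLp h 2 volume then T (hm.toLp h) else 0

section op

variable (T : L2 n →L[ℝ] L2 n) {h h₁ h₂ : E n → ℝ}

theorem op_of_memLp (hm : MemLp h 2 volume) : op T h = T (hm.toLp h) := by
  simp [op, hm]

theorem op_coe (f : L2 n) : op T f = T f := by
  rw [op_of_memLp T (Lp.memLp f), Lp.toLp_coeFn]

theorem op_congr_ae (h12 : h₁ =ᵐ[volume] h₂) : op T h₁ = op T h₂ := by
  by_cases hm : MemLp h₁ 2 volume
  · have hm2 := (memLp_congr_ae h12).1 hm
    rw [op_of_memLp T hm, op_of_memLp T hm2, (MemLp.toLp_eq_toLp_iff hm hm2).2 h12]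
  · have hm2 : ¬ MemLp h₂ 2 volume := fun h => hm ((memLp_congr_ae h12).2 h)
    simp [op, hm, hm2]

theorem op_zero_ae (h0 : h =ᵐ[volume] 0) : op T h =ᵐ[volume] 0 := by
  rw [op_congr_ae T h0, op_of_memLp T MemLp.zero, MemLp.toLp_zero, map_zero]
  exact Lp.coeFn_zero _ _ _

theorem op_add (hm₁ : MemLp h₁ 2 volume) (hm₂ : MemLp h₂ 2 volume) :
    op T (h₁ + h₂) =ᵐ[volume] op T h₁ + op T h₂ := by
  rw [op_of_memLp T hm₁, op_of_memLp T hm₂, op_of_memLp T (hm₁.add hm₂), MemLp.toLp_add, map_add]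
  exact Lp.coeFn_add _ _

theorem op_smul (c : ℝ) (hm : MemLp h 2 volume) :
    op T (c • h) =ᵐ[volume] c • op T h := by
  rw [op_of_memLp T hm, op_of_memLp T (hm.const_smul c), MemLp.toLp_const_smul, map_smul]
  exact Lp.coeFn_smul _ _

theorem op_sum {ι : Type*} (s : Finset ι) (h : ι → E n → ℝ) (hm : ∀ i ∈ s, MemLp (h i) 2 volume) :
    op T (∑ i ∈ s, h i) =ᵐ[volume] ∑ i ∈ s, op T (h i) := by
  classical
  induction s using Finset.induction_on with
  | empty => simpa using op_zero_ae T (ae_eq_refl 0)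
  | insert a s ha ih =>
    have h1 := ih fun i hi => hm i (Finset.mem_insert_of_mem hi)
    rw [Finset.sum_insert ha, Finset.sum_insert ha]
    refine (op_add T (hm a (by simp)) ?_).trans ((ae_eq_refl _).add h1)
    exact memLp_finsetSum' s fun i hi => hm i (Finset.mem_insert_of_mem hi)

theorem memLp_op (h : E n → ℝ) : MemLp (op T h) 2 volume := by
  unfold op
  split_ifs with hm
  · exact Lp.memLp _
  · exact MemLp.zero'

theorem aemeasurable_op (h : E n → ℝ) : AEMeasurable (op T h) volume :=
  (memLp_op T h).1.aemeasurable

theorem lintegral_op_sq_le (hm : MemLp h 2 volume) :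
    ∫⁻ x, ‖op T h x‖ₑ ^ 2 ≤ ‖T‖ₑ ^ 2 * ∫⁻ x, ‖h x‖ₑ ^ 2 := by
  have e : ∀ u : E n → ℝ, ∫⁻ x, ‖u x‖ₑ ^ 2 = eLpNorm u 2 volume ^ 2 := by
    intro u
    have := eLpNorm_nnreal_pow_eq_lintegral (f := u) (p := 2) (μ := volume) (by simp)
    simpa using this.symm
  rw [e, e, ← mul_pow]
  gcongr
  rw [op_of_memLp T hm, ← Lp.enorm_def, ← Lp.enorm_toLp hm]
  exact T.le_opENorm _

end op

/-! ### Standard kernels -/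

/-- The constant in the tail estimate `lintegral_tail_le`. -/
noncomputable def tailConst (n : ℕ) (ε : ℝ) : ℝ≥0∞ :=
  2 ^ n * (1 - ENNReal.ofReal ((2 : ℝ) ^ (-ε)))⁻¹

theorem tailConst_ne_top (n : ℕ) {ε : ℝ} (hε : 0 < ε) : tailConst n ε ≠ ∞ := by
  refine ENNReal.mul_ne_top (by simp) (ENNReal.inv_ne_top.2 ?_)
  rw [Ne, tsub_eq_zero_iff_le, not_le, ENNReal.ofReal_lt_one]
  exact Real.rpow_lt_one_of_one_lt_of_neg one_lt_two (by linarith)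

/-- A kernel decaying like `r ^ ε / |y - x₀| ^ (n + ε)` away from `x₀`, integrated against a
function whose averages over all balls around `x₀` are at most `M`: decompose the complement of the
ball into dyadic annuli. -/
theorem lintegral_tail_le {ε : ℝ} (hε : 0 < ε) (x₀ : E n) {r : ℝ} (hr : 0 < r) {φ : E n → ℝ≥0∞}
    (hφ : AEMeasurable φ volume) {M : ℝ≥0∞}
    (hM : ∀ R, r ≤ R → ∫⁻ y in ball x₀ R, φ y ≤ M * ENNReal.ofReal (R ^ n)) :
    ∫⁻ y in (ball x₀ r)ᶜ, ENNReal.ofReal (r ^ ε / ‖y - x₀‖ ^ ((n : ℝ) + ε)) * φ y ≤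
      tailConst n ε * M := by
  set a : ℕ → ℝ := fun k => r ^ ε / (2 ^ k * r) ^ ((n : ℝ) + ε) with ha
  have hpt : ∀ y ∈ (ball x₀ r)ᶜ, ENNReal.ofReal (r ^ ε / ‖y - x₀‖ ^ ((n : ℝ) + ε)) * φ y ≤
      ∑' k : ℕ, ENNReal.ofReal (a k) * (ball x₀ (2 ^ (k + 1) * r)).indicator φ y := by
    intro y hy
    have hy' : r ≤ ‖y - x₀‖ := by simpa [dist_eq_norm] using hy
    obtain ⟨k, hk1, hk2⟩ := exists_nat_pow_near (x := ‖y - x₀‖ / r) (y := 2)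
      (by rwa [le_div_iff₀ hr, one_mul]) one_lt_two
    rw [le_div_iff₀ hr] at hk1
    rw [div_lt_iff₀ hr] at hk2
    refine le_trans ?_ (ENNReal.le_tsum k)
    rw [indicator_of_mem (by simpa [dist_eq_norm] using hk2)]
    simp only [ha]
    gcongr
  have hint : ∀ k : ℕ, ENNReal.ofReal (a k) * ∫⁻ y in ball x₀ (2 ^ (k + 1) * r), φ y ≤
      2 ^ n * M * ENNReal.ofReal ((2 : ℝ) ^ (-ε)) ^ k := by
    intro k
    have h1 : r ≤ 2 ^ (k + 1) * r := by
      nlinarith [one_le_pow₀ (one_le_two (α := ℝ)) (n := k + 1)]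
    have e : a k * (2 ^ (k + 1) * r) ^ n = 2 ^ n * ((2 : ℝ) ^ (-ε)) ^ k := by
      have h2 : (0 : ℝ) < 2 ^ k := by positivity
      have h3 : ((2 : ℝ) ^ k) ^ ε = ((2 : ℝ) ^ ε) ^ k := by
        rw [← Real.rpow_natCast, ← Real.rpow_natCast, ← Real.rpow_mul zero_le_two,
          ← Real.rpow_mul zero_le_two, mul_comm]
      simp only [ha]
      rw [Real.rpow_add (by positivity), Real.mul_rpow h2.le hr.le (z := ε), Real.rpow_natCast,
        Real.rpow_neg zero_le_two, h3, inv_pow, pow_succ, show (2 : ℝ) ^ k * 2 * r =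
        2 * (2 ^ k * r) by ring, mul_pow 2]
      have : r ^ ε ≠ 0 := (Real.rpow_pos_of_pos hr _).ne'
      field_simp
    calc _ ≤ ENNReal.ofReal (a k) * (M * ENNReal.ofReal ((2 ^ (k + 1) * r) ^ n)) := by
          gcongr; exact hM _ h1
      _ = M * ENNReal.ofReal (a k * (2 ^ (k + 1) * r) ^ n) := by
          rw [ENNReal.ofReal_mul (by positivity)]; ring
      _ = _ := by
          rw [e, ENNReal.ofReal_mul (by positivity), ENNReal.ofReal_pow (by positivity),
            ENNReal.ofReal_pow (by positivity)]
          simp only [ENNReal.ofReal_ofNat]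
          ring
  calc _ ≤ ∫⁻ y in (ball x₀ r)ᶜ,
        ∑' k : ℕ, ENNReal.ofReal (a k) * (ball x₀ (2 ^ (k + 1) * r)).indicator φ y :=
        setLIntegral_mono' measurableSet_ball.compl hpt
    _ ≤ ∫⁻ y, ∑' k : ℕ, ENNReal.ofReal (a k) * (ball x₀ (2 ^ (k + 1) * r)).indicator φ y :=
        setLIntegral_le_lintegral _ _
    _ = ∑' k : ℕ, ENNReal.ofReal (a k) * ∫⁻ y in ball x₀ (2 ^ (k + 1) * r), φ y := by
        rw [lintegral_tsum fun k => (hφ.indicator measurableSet_ball).const_mul _]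
        congr 1 with k
        rw [lintegral_const_mul'' _ (hφ.indicator measurableSet_ball),
          lintegral_indicator measurableSet_ball]
    _ ≤ ∑' k : ℕ, 2 ^ n * M * ENNReal.ofReal ((2 : ℝ) ^ (-ε)) ^ k := ENNReal.tsum_le_tsum hint
    _ = tailConst n ε * M := by
        rw [ENNReal.tsum_mul_left, ENNReal.tsum_geometric, tailConst]; ring

theorem volume_ball_eq (x : E n) {r : ℝ} (hr : 0 < r) :
    volume (ball x r) = ENNReal.ofReal (r ^ n) * volume (ball (0 : E n) 1) := by
  simpa using Measure.addHaar_ball_of_pos volume x hr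

namespace IsStandardKernel

variable {K : E n → E n → ℝ} {ε A : ℝ} (hK : IsStandardKernel K ε A)
include hK

theorem nonneg (hn : 1 ≤ n) : 0 ≤ A := by
  have := Fin.pos_iff_nonempty.1 hn
  obtain ⟨x, hx⟩ := exists_ne (0 : E n)
  have h := (abs_nonneg _).trans (hK.size x 0 hx)
  have h2 : 0 < ‖x - 0‖ ^ n := by have := norm_pos_iff.2 hx; simp only [sub_zero]; positivity
  by_contra! hA
  linarith [div_neg_of_neg_of_pos hA h2]

theorem abs_sub_left_le (hε : 0 < ε) (hA : 0 ≤ A) {x x₀ y : E n} {r : ℝ} (hx : x ∈ ball x₀ r)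
    (hy : 2 * r ≤ ‖y - x₀‖) :
    |K x y - K x₀ y| ≤ A * ((2 * r) ^ ε / ‖y - x₀‖ ^ ((n : ℝ) + ε)) := by
  rw [mem_ball, dist_eq_norm] at hx
  have hr : 0 < r := (norm_nonneg _).trans_lt hx
  have hne : x₀ ≠ y := by rintro rfl; simp at hy; linarith
  have h := hK.regularity x₀ y (x - x₀) hne (by rw [norm_sub_rev x₀ y]; linarith)
  rw [add_sub_cancel, norm_sub_rev x₀ y] at h
  calc _ ≤ A * ‖x - x₀‖ ^ ε / ‖y - x₀‖ ^ ((n : ℝ) + ε) :=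
        le_trans (le_add_of_nonneg_right (abs_nonneg _)) h
    _ ≤ _ := by
        rw [mul_div_assoc]
        gcongr
        linarith

theorem abs_sub_right_le (hε : 0 < ε) (hA : 0 ≤ A) {x x₀ y : E n} {r : ℝ} (hx : x ∈ ball x₀ r)
    (hy : 2 * r ≤ ‖y - x₀‖) :
    |K y x - K y x₀| ≤ A * ((2 * r) ^ ε / ‖y - x₀‖ ^ ((n : ℝ) + ε)) := by
  rw [mem_ball, dist_eq_norm] at hx
  have hr : 0 < r := (norm_nonneg _).trans_lt hx
  have hne : y ≠ x₀ := by rintro rfl; simp at hy; linarith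
  have h := hK.regularity y x₀ (x - x₀) hne (by linarith)
  rw [add_sub_cancel] at h
  calc _ ≤ A * ‖x - x₀‖ ^ ε / ‖y - x₀‖ ^ ((n : ℝ) + ε) :=
        le_trans (le_add_of_nonneg_left (abs_nonneg _)) h
    _ ≤ _ := by
        rw [mul_div_assoc]
        gcongr
        linarith

theorem lintegral_sub_mul_le (hε : 0 < ε) (hA : 0 ≤ A) {x x₀ : E n} {r : ℝ} (hx : x ∈ ball x₀ r)
    {h : E n → ℝ} (hh : AEMeasurable h volume) {M : ℝ≥0∞}
    (hM : ∀ R, 2 * r ≤ R → ∫⁻ y in ball x₀ R, ‖h y‖ₑ ≤ M * ENNReal.ofReal (R ^ n)) :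
    ∫⁻ y in (ball x₀ (2 * r))ᶜ, ‖(K x y - K x₀ y) * h y‖ₑ ≤
      ENNReal.ofReal A * (tailConst n ε * M) := by
  have hr : 0 < 2 * r := by linarith [dist_nonneg.trans_lt (mem_ball.1 hx)]
  calc _ ≤ ∫⁻ y in (ball x₀ (2 * r))ᶜ, ENNReal.ofReal A *
        (ENNReal.ofReal ((2 * r) ^ ε / ‖y - x₀‖ ^ ((n : ℝ) + ε)) * ‖h y‖ₑ) := by
        refine setLIntegral_mono' measurableSet_ball.compl fun y hy => ?_
        rw [enorm_mul, ← mul_assoc, ← ENNReal.ofReal_mul hA]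
        gcongr
        rw [Real.enorm_eq_ofReal_abs]
        refine ENNReal.ofReal_le_ofReal (hK.abs_sub_left_le hε hA hx ?_)
        simpa [dist_eq_norm] using hy
    _ ≤ _ := by
        rw [lintegral_const_mul' _ _ ENNReal.ofReal_ne_top]
        gcongr
        exact lintegral_tail_le hε x₀ hr hh.enorm hM

end IsStandardKernel

/-- `T 1 = 0` makes `T 1_{2B}` constant on `B` up to a bounded error, and the `L²` bound controls
the constant. This is the only way in which the cancellation of `T` is used. -/
theorem exists_forall_enorm_op_indicator_ball_le {T : L2 n →L[ℝ] L2 n} {K : E n → E n → ℝ}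
    (hn : 1 ≤ n) (hT : IsCalderonZygmund T K) (h1 : EqInBMO T K (fun _ => 1) (fun _ => 0)) :
    ∃ C : ℝ≥0, ∀ (x₀ : E n) (r : ℝ), 0 < r → ∀ᵐ x : E n, x ∈ ball x₀ r →
      ‖op T ((ball x₀ (2 * r)).indicator fun _ => 1) x‖ₑ ≤ C := by
  obtain ⟨ε, A, hε, hK⟩ := hT.kernel
  have hA := hK.nonneg hn
  set v : ℝ≥0∞ := volume (ball (0 : E n) 1)
  set D : ℝ≥0∞ := ENNReal.ofReal A * (tailConst n ε * v)
  have hD : D ≠ ∞ := ENNReal.mul_ne_top ENNReal.ofReal_ne_top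
    (ENNReal.mul_ne_top (tailConst_ne_top n hε) measure_ball_lt_top.ne)
  have hC : D + ‖T‖ₑ * 2 ^ n + D ≠ ∞ := by
    simp [hD, ENNReal.add_eq_top, ENNReal.mul_eq_top]
  refine ⟨(D + ‖T‖ₑ * 2 ^ n + D).toNNReal, fun x₀ r hr => ?_⟩
  rw [ENNReal.coe_toNNReal hC]
  obtain ⟨g, hg, c, hc⟩ := h1.2 x₀ r hr
  have hind : MemLp ((ball x₀ (2 * r)).indicator fun _ => (1 : ℝ)) 2 volume :=
    memLp_indicator_const 2 measurableSet_ball 1 (Or.inr measure_ball_lt_top.ne)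
  set G := op T ((ball x₀ (2 * r)).indicator fun _ => 1) with hG
  have hGg : G = T g := by rw [hG, ← op_congr_ae T hg, op_coe]
  rw [← hGg] at hc
  have hI : ∀ x ∈ ball x₀ r, ‖∫ y in (ball x₀ (2 * r))ᶜ, (K x y - K x₀ y) * 1‖ₑ ≤ D := by
    intro x hx
    refine (enorm_integral_le_lintegral_enorm _).trans ?_
    refine hK.lintegral_sub_mul_le hε hA hx (h := fun _ => 1) aemeasurable_const ?_
    intro R hR
    simp only [enorm_one, setLIntegral_const, one_mul]
    rw [volume_ball_eq x₀ (by linarith), mul_comm]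
  have hcD : ‖c‖ₑ ≤ D + ‖T‖ₑ * 2 ^ n := by
    rw [← tsub_le_iff_left]
    refine (ENNReal.pow_le_pow_left_iff two_ne_zero).1 ?_
    have hB0 : volume (ball x₀ r) ≠ 0 := (measure_ball_pos _ _ hr).ne'
    have hBt : volume (ball x₀ r) ≠ ∞ := measure_ball_lt_top.ne
    rw [← ENNReal.mul_le_mul_iff_left hB0 hBt]
    calc (‖c‖ₑ - D) ^ 2 * volume (ball x₀ r) = ∫⁻ x in ball x₀ r, (‖c‖ₑ - D) ^ 2 := by simp
      _ ≤ ∫⁻ x in ball x₀ r, ‖G x‖ₑ ^ 2 := by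
        refine setLIntegral_mono_ae' measurableSet_ball ?_
        filter_upwards [hc] with x hx hxB
        gcongr
        rw [tsub_le_iff_left]
        have e : c = -(∫ y in (ball x₀ (2 * r))ᶜ, (K x y - K x₀ y) * 1) - G x := by
          linarith [hx hxB]
        rw [e]
        refine (enorm_sub_le).trans ?_
        rw [enorm_neg]
        gcongr
        exact hI x hxB
      _ ≤ ∫⁻ x, ‖G x‖ₑ ^ 2 := setLIntegral_le_lintegral _ _
      _ ≤ _ := lintegral_op_sq_le T hind
      _ = ‖T‖ₑ ^ 2 * volume (ball x₀ (2 * r)) := by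
        rw [← lintegral_indicator_one measurableSet_ball]
        congr 2 with x
        by_cases hx : x ∈ ball x₀ (2 * r) <;> simp [indicator, hx]
      _ = ‖T‖ₑ ^ 2 * 2 ^ n * volume (ball x₀ r) := by
        rw [volume_ball_eq x₀ hr, volume_ball_eq x₀ (by positivity), mul_pow,
          ENNReal.ofReal_mul (by positivity), ENNReal.ofReal_pow zero_le_two]
        simp only [ENNReal.ofReal_ofNat]
        ring
      _ ≤ _ := by
        rw [mul_pow]
        exact mul_le_mul' (mul_le_mul' le_rfl
          (le_self_pow₀ (one_le_pow₀ (one_le_two (α := ℝ≥0∞))) two_ne_zero)) le_rfl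
  filter_upwards [hc] with x hx hxB
  have e : G x = -(∫ y in (ball x₀ (2 * r))ᶜ, (K x y - K x₀ y) * 1) - c := by
    linarith [hx hxB]
  rw [e]
  refine (enorm_sub_le).trans ?_
  rw [enorm_neg, add_comm]
  gcongr
  exact hI x hxB

/-! ### Maximal functions and stopping cubes -/

/-- The weak type `(1,1)` bound for the Hardy–Littlewood maximal function, from the Vitali covering
theorem. -/
theorem mul_volume_maximal_le (hn : 1 ≤ n) {φ : E n → ℝ≥0∞}
    (hφI : ∫⁻ y, φ y ≠ ∞) {l : ℝ≥0∞} (hl : l ≠ 0) (hlt : l ≠ ∞) :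
    l * volume {x : E n | ∃ R : ℝ, 0 < R ∧
        l * ENNReal.ofReal (R ^ n) < ∫⁻ y in closedBall x R, φ y} ≤
      4 ^ n * volume (ball (0 : E n) 1) * ∫⁻ y, φ y := by
  set t : Set (E n × ℝ) := {p | 0 < p.2 ∧
    l * ENNReal.ofReal (p.2 ^ n) < ∫⁻ y in closedBall p.1 p.2, φ y} with ht
  set I := ∫⁻ y, φ y with hI
  have hR : ∀ p ∈ t, p.2 ≤ max 1 (I / l).toReal := by
    rintro ⟨x, R⟩ ⟨hR0, hR1⟩
    by_contra! hlt'
    rw [max_lt_iff] at hlt'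
    have h1 : R ≤ R ^ n := le_self_pow₀ hlt'.1.le (by lia)
    have h2 : I / l < ENNReal.ofReal R :=
      (ENNReal.lt_ofReal_iff_toReal_lt (ENNReal.div_ne_top hφI hl)).2 hlt'.2
    have h3 : I < l * ENNReal.ofReal (R ^ n) := by
      rw [mul_comm]
      exact (ENNReal.div_lt_iff (Or.inl hl) (Or.inl hlt)).1
        (h2.trans_le (ENNReal.ofReal_le_ofReal h1))
    exact absurd (h3.trans hR1) (setLIntegral_le_lintegral _ _).not_gt
  obtain ⟨u, hut, hud, hu⟩ := Vitali.exists_disjoint_subfamily_covering_enlargement_closedBall t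
    Prod.fst Prod.snd _ hR 4 (by norm_num)
  have huc : u.Countable := hud.countable_of_nonempty_interior fun p hp =>
    ⟨p.1, ball_subset_interior_closedBall (mem_ball_self (hut hp).1)⟩
  have hsub : {x : E n | ∃ R : ℝ, 0 < R ∧
      l * ENNReal.ofReal (R ^ n) < ∫⁻ y in closedBall x R, φ y} ⊆
      ⋃ p ∈ u, closedBall p.1 (4 * p.2) := by
    rintro x ⟨R, hR0, hR1⟩
    obtain ⟨b, hb, hb2⟩ := hu (x, R) ⟨hR0, hR1⟩
    exact mem_biUnion hb (hb2 (mem_closedBall_self hR0.le))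
  calc _ ≤ l * ∑' p : u, volume (closedBall p.1.1 (4 * p.1.2)) := by
        gcongr
        exact (measure_mono hsub).trans (measure_biUnion_le _ huc _)
    _ = ∑' p : u, 4 ^ n * volume (ball (0 : E n) 1) * (l * ENNReal.ofReal (p.1.2 ^ n)) := by
        rw [← ENNReal.tsum_mul_left]
        congr 1 with p
        have h0 := (hut p.2).1
        rw [Measure.addHaar_closedBall _ _ (by positivity)]
        simp only [finrank_euclideanSpace, Fintype.card_fin]
        rw [mul_pow, ENNReal.ofReal_mul (by positivity), ENNReal.ofReal_pow (by positivity)]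
        simp only [ENNReal.ofReal_ofNat]
        ring
    _ ≤ ∑' p : u, 4 ^ n * volume (ball (0 : E n) 1) * ∫⁻ y in closedBall p.1.1 p.1.2, φ y := by
        refine ENNReal.tsum_le_tsum fun p => ?_
        gcongr
        exact (hut p.2).2.le
    _ = 4 ^ n * volume (ball (0 : E n) 1) * ∫⁻ y in ⋃ p ∈ u, closedBall p.1 p.2, φ y := by
        rw [ENNReal.tsum_mul_left, lintegral_biUnion huc (fun p _ => measurableSet_closedBall) hud]
    _ ≤ _ := by
        gcongr
        exact setLIntegral_le_lintegral _ _

/-- Lebesgue differentiation along the cubes of the grid, in the form of a comparison. -/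
theorem ae_enorm_le_of_forall_lintegral_le (hn : 1 ≤ n) {h : E n → ℝ}
    (hh : LocallyIntegrable h volume) (l : ℝ≥0∞) : ∀ᵐ x : E n,
      (∀ k, ∫⁻ y in (Cube.containing k x).set, ‖h y‖ₑ ≤ l * volume (Cube.containing k x).set) →
      ‖h x‖ₑ ≤ l := by
  set 𝓥 := IsUnifLocDoublingMeasure.vitaliFamily (volume : Measure (E n)) 1
  have hn0 : (0 : ℝ) < n := by exact_mod_cast hn
  filter_upwards [𝓥.ae_tendsto_lintegral_enorm_sub_div hh] with x hx hk
  set Q : ℕ → Cube n := fun j => Cube.containing j x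
  have hδ : Tendsto (fun j => n * (Q j).side) atTop (𝓝[>] 0) := by
    refine tendsto_nhdsWithin_iff.2 ⟨?_, Eventually.of_forall fun j =>
      mul_pos hn0 (Q j).side_pos⟩
    have : Tendsto (fun j : ℕ => (n : ℝ) * (1 / 2) ^ j) atTop (𝓝 (n * 0)) :=
      (tendsto_pow_atTop_nhds_zero_of_lt_one (by norm_num) (by norm_num)).const_mul _
    rw [mul_zero] at this
    refine this.congr fun j => ?_
    simp [Q, Cube.side, Cube.containing]
  have hlim := hx.comp (IsUnifLocDoublingMeasure.tendsto_closedBall_filterAt (K := 1) volume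
    (fun j => (Q j).center) _ hδ (Eventually.of_forall fun j => by
      have := Cube.norm_sub_center_le (Cube.mem_containing j x)
      rw [mem_closedBall, dist_eq_norm, one_mul]
      have := (Q j).side_pos
      refine (Cube.norm_sub_center_le (Cube.mem_containing j x)).trans ?_
      gcongr
      exact half_le_self this.le))
  set C : ℝ≥0∞ := ENNReal.ofReal ((n : ℝ) ^ n) * volume (ball (0 : E n) 1)
  have hC : C ≠ ∞ := ENNReal.mul_ne_top ENNReal.ofReal_ne_top measure_ball_lt_top.ne
  have hvol : ∀ j, volume (closedBall (Q j).center (n * (Q j).side)) = C * volume (Q j).set := by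
    intro j
    have := (Q j).side_pos
    rw [Measure.addHaar_closedBall _ _ (by positivity), Cube.volume_set]
    simp only [finrank_euclideanSpace, Fintype.card_fin, C]
    rw [mul_pow, ENNReal.ofReal_mul (by positivity)]
    ring
  have hlim2 := (ENNReal.Tendsto.const_mul (a := C) hlim (Or.inr hC)).const_add l
  rw [mul_zero, add_zero] at hlim2
  refine ge_of_tendsto' hlim2 fun j => ?_
  have hv0 := (Q j).volume_set_ne_zero
  have hvt := (Q j).volume_set_ne_top
  have hC0 : C ≠ 0 := by
    have := measure_ball_pos (volume : Measure (E n)) 0 one_pos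
    simp only [C, ne_eq, mul_eq_zero, this.ne', or_false, ENNReal.ofReal_eq_zero, not_le]
    positivity
  simp only [Function.comp]
  rw [hvol, ← ENNReal.mul_le_mul_iff_left hv0 hvt]
  set J := ∫⁻ y in closedBall (Q j).center (n * (Q j).side), ‖h y - h x‖ₑ with hJ
  calc ‖h x‖ₑ * volume (Q j).set = ∫⁻ y in (Q j).set, ‖h x‖ₑ := by simp
    _ ≤ ∫⁻ y in (Q j).set, (‖h y‖ₑ + ‖h y - h x‖ₑ) := by
        refine lintegral_mono fun y => ?_
        have e : h x = h y - (h y - h x) := by ring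
        conv_lhs => rw [e]
        exact enorm_sub_le
    _ = (∫⁻ y in (Q j).set, ‖h y‖ₑ) + ∫⁻ y in (Q j).set, ‖h y - h x‖ₑ :=
        lintegral_add_left' hh.aestronglyMeasurable.aemeasurable.restrict.enorm _
    _ ≤ l * volume (Q j).set + J := by
        gcongr
        · exact hk j
        · refine lintegral_mono_set fun y hy => ?_
          have := (Q j).side_pos
          rw [mem_closedBall, dist_eq_norm]
          refine (Cube.norm_sub_center_le hy).trans ?_
          gcongr
          exact half_le_self this.le
    _ = (l + C * (J / (C * volume (Q j).set))) * volume (Q j).set := by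
        rw [add_mul]
        congr 1
        rw [mul_comm C, mul_assoc, ENNReal.div_mul_cancel]
        · exact mul_ne_zero hC0 hv0
        · exact ENNReal.mul_ne_top hC hvt

/-- The stopping cubes of an integrable function at height `l`: the maximal cubes of the grid on
which the mean of `|h|` exceeds `l`. -/
theorem exists_maximal_cubes (hn : 1 ≤ n) {h : E n → ℝ} (hh : Integrable h volume) {l : ℝ≥0∞}
    (hl : l ≠ 0) (hlt : l ≠ ∞) : ∃ 𝒬 : Set (Cube n), 𝒬.PairwiseDisjoint Cube.set ∧
      (∀ P ∈ 𝒬, l * volume P.set < ∫⁻ y in P.set, ‖h y‖ₑ) ∧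
      (∀ P ∈ 𝒬, ∀ Q : Cube n, Q.1 < P.1 → P.set ⊆ Q.set →
        ∫⁻ y in Q.set, ‖h y‖ₑ ≤ l * volume Q.set) ∧
      ∀ᵐ x : E n, (∀ P ∈ 𝒬, x ∉ P.set) → ‖h x‖ₑ ≤ l := by
  set sel : Cube n → Prop := fun Q => l * volume Q.set < ∫⁻ y in Q.set, ‖h y‖ₑ
  refine ⟨{P | sel P ∧ ∀ Q : Cube n, Q.1 < P.1 → P.set ⊆ Q.set → ¬ sel Q}, ?_,
    fun P hP => hP.1, fun P hP Q hQ1 hQ2 => not_lt.1 (hP.2 Q hQ1 hQ2), ?_⟩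
  · have key : ∀ P P' : Cube n, sel P → (∀ Q : Cube n, Q.1 < P'.1 → P'.set ⊆ Q.set → ¬ sel Q) →
        ∀ x, x ∈ P.set → x ∈ P'.set → P'.1 ≤ P.1 := by
      intro P P' hP hP' x hx hx'
      by_contra! hlt
      exact hP' P hlt (Cube.subset_of_mem hlt.le hx' hx) hP
    rintro P hP P' hP' hne
    refine disjoint_left.2 fun x hx hx' => hne ?_
    exact Cube.eq_of_mem ((key P P' hP.1 hP'.2 x hx hx').antisymm
      (key P' P hP'.1 hP.2 x hx' hx)) hx hx'
  · filter_upwards [ae_enorm_le_of_forall_lintegral_le hn hh.locallyIntegrable l] with x hx hx2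
    refine hx fun k => not_lt.1 fun hk => ?_
    have hI : ∫⁻ y, ‖h y‖ₑ ≠ ∞ := hh.2.ne
    obtain ⟨N, hN⟩ := ENNReal.exists_nat_gt (ENNReal.div_ne_top hI hl)
    have hbdd : ∀ j : ℤ, sel (Cube.containing j x) → -(N : ℤ) ≤ j := by
      intro j hj
      by_contra! hjN
      have h1 : (2 : ℝ) ^ N ≤ (Cube.containing j x).side := by
        rw [← zpow_natCast]
        exact zpow_le_zpow_right₀ one_le_two (by simp only [Cube.containing]; lia)
      have h2 : (N : ℝ) ≤ (Cube.containing j x).side ^ n :=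
        calc (N : ℝ) ≤ 2 ^ N := by exact_mod_cast Nat.lt_two_pow_self.le
          _ ≤ _ := h1
          _ ≤ _ := le_self_pow₀ ((one_le_pow₀ one_le_two).trans h1) (by lia)
      have h3 : ∫⁻ y, ‖h y‖ₑ < l * volume (Cube.containing j x).set := by
        rw [mul_comm, Cube.volume_set]
        refine (ENNReal.div_lt_iff (Or.inl hl) (Or.inl hlt)).1 (hN.trans_le ?_)
        rw [← ENNReal.ofReal_natCast]
        exact ENNReal.ofReal_le_ofReal h2
      exact absurd (h3.trans hj) (setLIntegral_le_lintegral _ _).not_gt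
    obtain ⟨k₀, hk₀, hmin⟩ := Int.exists_least_of_bdd (P := fun j => sel (Cube.containing j x))
      ⟨_, hbdd⟩ ⟨k, hk⟩
    refine hx2 (Cube.containing k₀ x) ⟨hk₀, fun Q hQ1 hQ2 hQ3 => ?_⟩ (Cube.mem_containing _ _)
    rw [Cube.eq_containing (hQ2 (Cube.mem_containing _ _))] at hQ3
    exact absurd (hmin _ hQ3) (by simpa [Cube.containing] using hQ1)

/-- Dominated convergence in `L²`, followed by the bounded operator `T` and the passage to an almost
everywhere convergent subsequence. -/
theorem exists_subseq_op_tendsto (T : L2 n →L[ℝ] L2 n) {b : E n → ℝ} (hb : MemLp b 2 volume)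
    {u : ℕ → E n → ℝ} (hu : ∀ j, AEStronglyMeasurable (u j) volume)
    (hub : ∀ j, ∀ᵐ x : E n, ‖u j x‖ₑ ≤ ‖b x‖ₑ)
    (hlim : ∀ᵐ x : E n, Tendsto (fun j => u j x) atTop (𝓝 (b x))) :
    ∃ ns : ℕ → ℕ, StrictMono ns ∧
      ∀ᵐ x : E n, Tendsto (fun j => op T (u (ns j)) x) atTop (𝓝 (op T b x)) := by
  have hum : ∀ j, MemLp (u j) 2 volume := fun j =>
    hb.mono (hu j) ((hub j).mono fun x hx => enorm_le_iff_norm_le.1 hx)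
  have hbI : ∫⁻ x, (2 * ‖b x‖ₑ) ^ 2 ≠ ∞ := by
    have := eLpNorm_nnreal_pow_eq_lintegral (f := b) (p := 2) (μ := volume) (by simp)
    simp only [mul_pow]
    rw [lintegral_const_mul' _ _ (by simp)]
    refine ENNReal.mul_ne_top (by simp) ?_
    have h2 : ∫⁻ x, ‖b x‖ₑ ^ 2 = eLpNorm b 2 volume ^ 2 := by simpa using this.symm
    rw [h2]
    exact ENNReal.pow_ne_top hb.2.ne
  have h0 : Tendsto (fun j => ∫⁻ x, ‖(u j - b) x‖ₑ ^ 2) atTop (𝓝 (∫⁻ _ : E n, 0)) := by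
    refine tendsto_lintegral_of_dominated_convergence' (fun x => (2 * ‖b x‖ₑ) ^ 2)
      (fun j => ((hu j).sub hb.1).aemeasurable.enorm.pow_const _) (fun j => ?_) hbI ?_
    · filter_upwards [hub j] with x hx
      gcongr
      calc ‖(u j - b) x‖ₑ ≤ ‖u j x‖ₑ + ‖b x‖ₑ := enorm_sub_le
        _ ≤ 2 * ‖b x‖ₑ := by rw [two_mul]; gcongr
    · filter_upwards [hlim] with x hx
      have h1 : Tendsto (fun j => ‖(u j - b) x‖ₑ ^ 2) atTop (𝓝 (‖b x - b x‖ₑ ^ 2)) :=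
        ENNReal.Tendsto.pow ((hx.sub_const _).enorm)
      simpa using h1
  rw [lintegral_zero] at h0
  have h1 : Tendsto (fun j => ∫⁻ x, ‖(op T (u j) - op T b) x‖ₑ ^ 2) atTop (𝓝 0) := by
    have h2 : Tendsto (fun j => ‖T‖ₑ ^ 2 * ∫⁻ x, ‖(u j - b) x‖ₑ ^ 2) atTop (𝓝 (‖T‖ₑ ^ 2 * 0)) :=
      ENNReal.Tendsto.const_mul h0 (Or.inr (by simp))
    rw [mul_zero] at h2
    refine tendsto_of_tendsto_of_tendsto_of_le_of_le tendsto_const_nhds h2 (fun j => zero_le)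
      fun j => ?_
    refine le_trans (le_of_eq ?_) (lintegral_op_sq_le T ((hum j).sub hb))
    refine lintegral_congr_ae ?_
    have h3 := op_add T ((hum j).sub hb) hb
    rw [sub_add_cancel] at h3
    filter_upwards [h3] with x hx
    simp [hx]
  have h4 : TendstoInMeasure volume (fun j => op T (u j)) atTop (op T b) := by
    refine tendstoInMeasure_of_tendsto_eLpNorm (p := 2) two_ne_zero
      (fun j => (memLp_op T _).1) (memLp_op T _).1 ?_
    have e : ∀ j, eLpNorm (op T (u j) - op T b) 2 volume =
        (∫⁻ x, ‖(op T (u j) - op T b) x‖ₑ ^ 2) ^ (1 / 2 : ℝ) := fun j => by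
      rw [eLpNorm_eq_lintegral_rpow_enorm_toReal (by simp) (by simp)]; simp
    simp only [e]
    have h5 := h1.ennrpow_const (1 / 2 : ℝ)
    simpa using h5
  exact h4.exists_seq_tendsto_ae

/-! ### The weak type bound for Calderón–Zygmund operators -/

theorem IsStandardKernel.continuousAt_right {K : E n → E n → ℝ} {ε A : ℝ}
    (hK : IsStandardKernel K ε A) (hε : 0 < ε) {x y : E n} (hxy : x ≠ y) :
    ContinuousAt (K x) y := by
  rw [ContinuousAt, tendsto_iff_norm_sub_tendsto_zero]
  have h0 : 0 < ‖x - y‖ := norm_sub_pos_iff.2 hxy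
  have hlim : Tendsto (fun w => A * ‖w - y‖ ^ ε / ‖x - y‖ ^ ((n : ℝ) + ε)) (𝓝 y) (𝓝 0) := by
    have h1 : Tendsto (fun w => ‖w - y‖) (𝓝 y) (𝓝 0) := by
      have : Continuous fun w : E n => ‖w - y‖ := by fun_prop
      simpa using this.tendsto y
    have h2 := (h1.rpow_const (p := ε) (Or.inr hε.le)).const_mul A
    rw [Real.zero_rpow hε.ne', mul_zero] at h2
    simpa using h2.div_const (‖x - y‖ ^ ((n : ℝ) + ε))
  refine squeeze_zero' (Eventually.of_forall fun _ => norm_nonneg _) ?_ hlim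
  have hU : ∀ᶠ w in 𝓝 y, 2 * ‖w - y‖ < ‖x - y‖ := by
    filter_upwards [ball_mem_nhds y (half_pos h0)] with w hw
    rw [mem_ball, dist_eq_norm] at hw
    linarith
  filter_upwards [hU] with w hw
  have := hK.regularity x y (w - y) hxy hw
  rw [add_sub_cancel] at this
  exact (le_add_of_nonneg_left (abs_nonneg _)).trans this

theorem IsStandardKernel.aemeasurable_right {K : E n → E n → ℝ} {ε A : ℝ}
    (hK : IsStandardKernel K ε A) (hε : 0 < ε) (hn : 1 ≤ n) (x : E n) :
    AEMeasurable (K x) volume := by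
  have := Fin.pos_iff_nonempty.1 hn
  have h1 : ContinuousOn (K x) {x}ᶜ := fun y hy =>
    (hK.continuousAt_right hε (Ne.symm hy)).continuousWithinAt
  have h2 := h1.aemeasurable (μ := volume) (measurableSet_singleton x).compl
  rwa [Measure.restrict_eq_self_of_ae_mem] at h2
  exact compl_mem_ae_iff.2 (measure_singleton x)

/-- `T` maps functions with mean zero supported in a ball to functions that are integrable away
from that ball, uniformly. -/
theorem lintegral_compl_ball_op_le {T : L2 n →L[ℝ] L2 n} {K : E n → E n → ℝ} {ε A : ℝ}
    (hn : 1 ≤ n) (hT : IsCalderonZygmund T K) (hε : 0 < ε) (hK : IsStandardKernel K ε A)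
    {c : E n} {r : ℝ} (hr : 0 < r) {b : E n → ℝ} (hb : MemLp b 2 volume)
    (hb1 : Integrable b volume) (hsupp : ∀ x ∉ closedBall c (r / 2), b x = 0)
    (hmean : ∫ x, b x = 0) :
    ∫⁻ x in (ball c (2 * r))ᶜ, ‖op T b x‖ₑ ≤
      ENNReal.ofReal A * (tailConst n ε * volume (ball (0 : E n) 1)) * ∫⁻ x, ‖b x‖ₑ := by
  have hA := hK.nonneg hn
  have hts : tsupport b ⊆ closedBall c (r / 2) :=
    closure_minimal (fun x hx => by_contra fun h => hx (hsupp x h)) isClosed_closedBall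
  have hcs : HasCompactSupport b := (isCompact_closedBall c (r / 2)).of_isClosed_subset
    (isClosed_tsupport b) hts
  set I := ∫⁻ x, ‖b x‖ₑ
  have hpt : ∀ᵐ x : E n, x ∈ (ball c (2 * r))ᶜ → ‖op T b x‖ₑ ≤
      ENNReal.ofReal A * I *
        (ENNReal.ofReal ((2 * r) ^ ε / ‖x - c‖ ^ ((n : ℝ) + ε)) * 1) := by
    filter_upwards [hT.assoc b hb hcs] with x hx hxB
    have hxc : 2 * r ≤ ‖x - c‖ := by simpa [dist_eq_norm] using hxB
    have hxs : x ∉ tsupport b := fun h => by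
      have := hts h
      rw [mem_closedBall, dist_eq_norm] at this
      linarith
    set a := A * ((2 * r) ^ ε / ‖x - c‖ ^ ((n : ℝ) + ε)) with ha
    have hbd : ∀ y, ‖(K x y - K x c) * b y‖ ≤ a * ‖b y‖ := by
      intro y
      by_cases hy : y ∈ closedBall c (r / 2)
      · rw [norm_mul]
        gcongr
        exact hK.abs_sub_right_le hε hA (closedBall_subset_ball (half_lt_self hr) hy) hxc
      · simp [hsupp y hy]
    have hint : Integrable (fun y => (K x y - K x c) * b y) volume :=
      (hb1.norm.const_mul a).mono'
        (((hK.aemeasurable_right hε hn x).sub_const _).aestronglyMeasurable.mul hb.1)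
        (Eventually.of_forall hbd)
    have e : op T b x = ∫ y, (K x y - K x c) * b y := by
      rw [op_of_memLp T hb, hx hxs]
      have : ∀ y, K x y * b y = (K x y - K x c) * b y + K x c * b y := fun y => by ring
      simp only [this]
      rw [integral_add hint (hb1.const_mul _), integral_const_mul, hmean]
      simp
    rw [e]
    calc _ ≤ ∫⁻ y, ‖(K x y - K x c) * b y‖ₑ := enorm_integral_le_lintegral_enorm _
      _ ≤ ∫⁻ y, ENNReal.ofReal a * ‖b y‖ₑ := by
          refine lintegral_mono fun y => ?_
          have := hbd y
          rw [← ofReal_norm, ← ofReal_norm (b y), ← ENNReal.ofReal_mul (by positivity)]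
          exact ENNReal.ofReal_le_ofReal this
      _ = _ := by
          rw [lintegral_const_mul' _ _ ENNReal.ofReal_ne_top, ha, ENNReal.ofReal_mul hA, mul_one]
          ring
  calc _ ≤ ∫⁻ x in (ball c (2 * r))ᶜ, ENNReal.ofReal A * I *
        (ENNReal.ofReal ((2 * r) ^ ε / ‖x - c‖ ^ ((n : ℝ) + ε)) * 1) :=
        setLIntegral_mono_ae' measurableSet_ball.compl hpt
    _ = ENNReal.ofReal A * I * ∫⁻ x in (ball c (2 * r))ᶜ,
          ENNReal.ofReal ((2 * r) ^ ε / ‖x - c‖ ^ ((n : ℝ) + ε)) * 1 :=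
        lintegral_const_mul' _ _ (ENNReal.mul_ne_top ENNReal.ofReal_ne_top hb1.2.ne)
    _ ≤ ENNReal.ofReal A * I * (tailConst n ε * volume (ball (0 : E n) 1)) := by
        gcongr
        refine lintegral_tail_le hε c (by positivity) aemeasurable_const fun R hR => ?_
        simp only [lintegral_const, one_mul, Measure.restrict_apply_univ]
        rw [volume_ball_eq c (by linarith), mul_comm]
    _ = _ := by ring

/-- The part of `h` on the cube `P` that has mean zero. -/
noncomputable def badPart (h : E n → ℝ) (P : Cube n) : E n → ℝ :=
  P.set.indicator fun x => h x - ⨍ y in P.set, h y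

section badPart

variable {h : E n → ℝ} (P : Cube n)

theorem Cube.isFiniteMeasure_restrict : IsFiniteMeasure (volume.restrict P.set) :=
  ⟨by simpa using P.volume_set_ne_top.lt_top⟩

theorem badPart_of_notMem {P : Cube n} {x : E n} (hx : x ∉ P.set) : badPart h P x = 0 :=
  indicator_of_notMem hx _

theorem memLp_badPart (hm : MemLp h 2 volume) : MemLp (badPart h P) 2 volume := by
  have := P.isFiniteMeasure_restrict
  rw [badPart, memLp_indicator_iff_restrict P.measurableSet_set]
  exact (hm.restrict _).sub (memLp_const _)

theorem integrable_badPart (hh : Integrable h volume) : Integrable (badPart h P) volume := by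
  have := P.isFiniteMeasure_restrict
  rw [badPart, integrable_indicator_iff P.measurableSet_set]
  exact hh.restrict.sub (integrable_const _)

theorem integral_badPart (hh : Integrable h volume) : ∫ x, badPart h P x = 0 := by
  have := P.isFiniteMeasure_restrict
  unfold badPart
  rw [integral_indicator P.measurableSet_set, integral_sub hh.restrict (integrable_const _),
    setIntegral_const, measureReal_def, setAverage_eq, measureReal_def, smul_smul,
    mul_inv_cancel₀, one_smul, sub_self]
  exact ENNReal.toReal_ne_zero.2 ⟨P.volume_set_ne_zero, P.volume_set_ne_top⟩

theorem enorm_setAverage_mul_le (h : E n → ℝ) {S : Set (E n)} (h0 : volume S ≠ 0)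
    (ht : volume S ≠ ∞) : ‖⨍ y in S, h y‖ₑ * volume S ≤ ∫⁻ y in S, ‖h y‖ₑ := by
  rw [setAverage_eq, enorm_smul, measureReal_def, enorm_inv, Real.enorm_of_nonneg (by positivity),
    ENNReal.ofReal_toReal ht, mul_right_comm, ENNReal.inv_mul_cancel h0 ht, one_mul]
  · exact enorm_integral_le_lintegral_enorm _
  · exact ENNReal.toReal_ne_zero.2 ⟨h0, ht⟩

theorem lintegral_badPart_le (h : E n → ℝ) :
    ∫⁻ x, ‖badPart h P x‖ₑ ≤ 2 * ∫⁻ y in P.set, ‖h y‖ₑ := by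
  simp only [badPart, enorm_indicator_eq_indicator_enorm]
  rw [lintegral_indicator P.measurableSet_set]
  set c := ⨍ y in P.set, h y with hc
  calc ∫⁻ x in P.set, ‖h x - c‖ₑ ≤ ∫⁻ x in P.set, (‖h x‖ₑ + ‖c‖ₑ) :=
        lintegral_mono fun x => enorm_sub_le
    _ = (∫⁻ x in P.set, ‖h x‖ₑ) + ‖c‖ₑ * volume P.set := by
        rw [lintegral_add_right _ measurable_const]; simp
    _ ≤ _ := by
        rw [two_mul]
        gcongr
        exact enorm_setAverage_mul_le h P.volume_set_ne_zero P.volume_set_ne_top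

end badPart

/-- The Calderón–Zygmund decomposition `h = (h - b) + b` at height `l`. The bad part `b` is the sum
of the functions `badPart h P` over the stopping cubes `P`, presented as the pointwise limit of
finite partial sums. -/
theorem exists_calderonZygmund_decomposition (hn : 1 ≤ n) {h : E n → ℝ} (hm : MemLp h 2 volume)
    (hh : Integrable h volume) {l : ℝ≥0∞} (hl : l ≠ 0) (hlt : l ≠ ∞) :
    ∃ (𝒬 : Set (Cube n)) (F : ℕ → Finset 𝒬) (b : E n → ℝ),
      l * ∑' P : 𝒬, volume P.1.set ≤ ∫⁻ x, ‖h x‖ₑ ∧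
      ∑' P : 𝒬, ∫⁻ x, ‖badPart h P x‖ₑ ≤ 2 * ∫⁻ x, ‖h x‖ₑ ∧
      MemLp b 2 volume ∧ MemLp (h - b) 2 volume ∧
      ∫⁻ x, ‖(h - b) x‖ₑ ^ 2 ≤ 2 ^ n * l * (3 * ∫⁻ x, ‖h x‖ₑ) ∧
      (∀ j x, (∑ P ∈ F j, badPart h P.1) x = b x ∨ (∑ P ∈ F j, badPart h P.1) x = 0) ∧
      ∀ x, Tendsto (fun j => (∑ P ∈ F j, badPart h P.1) x) atTop (𝓝 (b x)) := by
  obtain ⟨𝒬, hdisj, hlow, hup, hout⟩ := exists_maximal_cubes hn hh hl hlt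
  set I := ∫⁻ x, ‖h x‖ₑ with hI
  have hIt : I ≠ ∞ := hh.2.ne
  have hc : 𝒬.Countable := 𝒬.to_countable
  have hsum : ∑' P : 𝒬, ∫⁻ y in P.1.set, ‖h y‖ₑ ≤ I := by
    rw [← lintegral_biUnion hc (fun P _ => P.measurableSet_set) hdisj]
    exact setLIntegral_le_lintegral _ _
  have hBsum : ∑' P : 𝒬, ∫⁻ x, ‖badPart h P x‖ₑ ≤ 2 * I := by
    calc _ ≤ ∑' P : 𝒬, 2 * ∫⁻ y in P.1.set, ‖h y‖ₑ :=
          ENNReal.tsum_le_tsum fun P => lintegral_badPart_le P.1 h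
      _ ≤ 2 * I := by
          rw [ENNReal.tsum_mul_left]
          gcongr
  have hone : ∀ P ∈ 𝒬, ∀ x ∈ P.set, ∀ P' ∈ 𝒬, P' ≠ P → badPart h P' x = 0 := by
    intro P hP x hx P' hP' hne
    exact badPart_of_notMem fun hx' => disjoint_left.1 (hdisj hP' hP hne) hx' hx
  -- the finite partial sums of the bad parts
  obtain ⟨F, hF⟩ := exists_seq_tendsto (atTop : Filter (Finset 𝒬))
  set u : ℕ → E n → ℝ := fun j => ∑ P ∈ F j, badPart h P.1 with hu
  set b : E n → ℝ := fun x => ∑' P : 𝒬, badPart h P x with hb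
  have hbP : ∀ P ∈ 𝒬, ∀ x ∈ P.set, b x = badPart h P x := fun P hP x hx =>
    tsum_eq_single (⟨P, hP⟩ : 𝒬) fun P' hne =>
      hone P hP x hx P' P'.2 fun h => hne (Subtype.ext h)
  have hb0 : ∀ x, (∀ P ∈ 𝒬, x ∉ P.set) → b x = 0 := fun x hx => by
    simp only [hb]
    rw [tsum_congr fun P : 𝒬 => badPart_of_notMem (hx P P.2), tsum_zero]
  have husum : ∀ j x, u j x = ∑ P ∈ F j, badPart h P.1 x := fun j x => Finset.sum_apply _ _ _
  have hueq : ∀ j x, u j x = b x ∨ u j x = 0 := by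
    intro j x
    by_cases hx : ∃ P ∈ 𝒬, x ∈ P.set
    · obtain ⟨P, hP, hx⟩ := hx
      by_cases hPF : (⟨P, hP⟩ : 𝒬) ∈ F j
      · left
        rw [hbP P hP x hx, husum]
        exact Finset.sum_eq_single_of_mem _ hPF fun P' _ hne =>
          hone P hP x hx P' P'.2 fun h => hne (Subtype.ext h)
      · right
        rw [husum]
        refine Finset.sum_eq_zero fun P' hP' => hone P hP x hx P' P'.2 fun h => hPF ?_
        rwa [show (⟨P, hP⟩ : 𝒬) = P' from Subtype.ext h.symm]
    · push Not at hx
      right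
      rw [husum]
      exact Finset.sum_eq_zero fun P' _ => badPart_of_notMem (hx P' P'.2)
  have hulim : ∀ x, Tendsto (fun j => u j x) atTop (𝓝 (b x)) := by
    intro x
    refine tendsto_const_nhds.congr' ?_
    by_cases hx : ∃ P ∈ 𝒬, x ∈ P.set
    · obtain ⟨P, hP, hx⟩ := hx
      filter_upwards [hF.eventually (eventually_ge_atTop {(⟨P, hP⟩ : 𝒬)})] with j hj
      have hPF : (⟨P, hP⟩ : 𝒬) ∈ F j := hj (by simp)
      rw [hbP P hP x hx, husum]
      exact (Finset.sum_eq_single_of_mem _ hPF fun P' _ hne =>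
          hone P hP x hx P' P'.2 fun h => hne (Subtype.ext h)).symm
    · push Not at hx
      refine Eventually.of_forall fun j => ?_
      rcases hueq j x with h | h
      · exact h.symm
      · exact (hb0 x hx).trans h.symm
  have hum : ∀ j, MemLp (u j) 2 volume := fun j => memLp_finsetSum' _ fun P _ => memLp_badPart _ hm
  have hbm : AEStronglyMeasurable b volume :=
    aestronglyMeasurable_of_tendsto_ae atTop (fun j => (hum j).1) (Eventually.of_forall hulim)
  have hbI : ∫⁻ x, ‖b x‖ₑ ≤ 2 * I := by
    refine le_trans ?_ hBsum
    rw [← lintegral_tsum fun P : 𝒬 => (memLp_badPart P.1 hm).1.aemeasurable.enorm]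
    refine lintegral_mono fun x => ?_
    by_cases hx : ∃ P ∈ 𝒬, x ∈ P.set
    · obtain ⟨P, hP, hx⟩ := hx
      rw [hbP P hP x hx]
      exact ENNReal.le_tsum (f := fun P : 𝒬 => ‖badPart h P x‖ₑ) ⟨P, hP⟩
    · push Not at hx
      simp [hb0 x hx]
  -- the good part
  set G : E n → ℝ := h - b with hG
  have hGm : AEStronglyMeasurable G volume := hm.1.sub hbm
  have hGI : ∫⁻ x, ‖G x‖ₑ ≤ 3 * I := by
    calc _ ≤ ∫⁻ x, (‖h x‖ₑ + ‖b x‖ₑ) := lintegral_mono fun x => enorm_sub_le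
      _ = I + ∫⁻ x, ‖b x‖ₑ := lintegral_add_left' hm.1.aemeasurable.enorm _
      _ ≤ I + 2 * I := by gcongr
      _ = 3 * I := by ring
  have hGl : ∀ᵐ x : E n, ‖G x‖ₑ ≤ 2 ^ n * l := by
    filter_upwards [hout] with x hx
    by_cases hxP : ∃ P ∈ 𝒬, x ∈ P.set
    · obtain ⟨P, hP, hxP⟩ := hxP
      have e : G x = ⨍ y in P.set, h y := by
        simp [hG, hbP P hP x hxP, badPart, hxP]
      rw [e, ← ENNReal.mul_le_mul_iff_left P.volume_set_ne_zero P.volume_set_ne_top]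
      calc _ ≤ ∫⁻ y in P.set, ‖h y‖ₑ :=
            enorm_setAverage_mul_le h P.volume_set_ne_zero P.volume_set_ne_top
        _ ≤ ∫⁻ y in P.parent.set, ‖h y‖ₑ := lintegral_mono_set P.subset_parent
        _ ≤ l * volume P.parent.set :=
          hup P hP _ (by simp [Cube.parent, Cube.containing]) P.subset_parent
        _ = _ := by rw [P.volume_parent]; ring
    · push Not at hxP
      simp only [hG, Pi.sub_apply, hb0 x hxP, sub_zero]
      exact (hx hxP).trans (le_mul_of_one_le_left zero_le (one_le_pow₀ (one_le_two (α := ℝ≥0∞))))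
  have hGsq : ∫⁻ x, ‖G x‖ₑ ^ 2 ≤ 2 ^ n * l * (3 * I) := by
    calc _ ≤ ∫⁻ x, 2 ^ n * l * ‖G x‖ₑ := by
          refine lintegral_mono_ae (hGl.mono fun x hx => ?_)
          rw [pow_two]
          gcongr
      _ = 2 ^ n * l * ∫⁻ x, ‖G x‖ₑ := lintegral_const_mul'' _ hGm.aemeasurable.enorm
      _ ≤ _ := by gcongr
  have hG2 : MemLp G 2 volume := by
    refine ⟨hGm, ?_⟩
    have := eLpNorm_nnreal_pow_eq_lintegral (f := G) (p := 2) (μ := volume) (by simp)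
    have h2 : ∫⁻ x, ‖G x‖ₑ ^ 2 = eLpNorm G 2 volume ^ 2 := by simpa using this.symm
    rw [h2] at hGsq
    have h3 : eLpNorm G 2 volume ^ 2 < ∞ := hGsq.trans_lt
      (ENNReal.mul_lt_top (ENNReal.mul_lt_top (by simp) hlt.lt_top)
        (ENNReal.mul_lt_top (by simp) hIt.lt_top))
    exact (ENNReal.pow_lt_top_iff.1 h3).resolve_right two_ne_zero
  have hb2 : MemLp b 2 volume := by
    have e : b = h - G := by simp [hG]
    rw [e]; exact hm.sub hG2
  refine ⟨𝒬, F, b, ?_, hBsum, hb2, hG2, hGsq, hueq, hulim⟩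
  calc _ = ∑' P : 𝒬, l * volume P.1.set := ENNReal.tsum_mul_left.symm
    _ ≤ ∑' P : 𝒬, ∫⁻ y in P.1.set, ‖h y‖ₑ := ENNReal.tsum_le_tsum fun P => (hlow P.1 P.2).le
    _ ≤ I := hsum

/-- The weak type `(1,1)` bound, by the Calderón–Zygmund decomposition. -/
theorem exists_mul_volume_op_le {T : L2 n →L[ℝ] L2 n} {K : E n → E n → ℝ}
    (hn : 1 ≤ n) (hT : IsCalderonZygmund T K) : ∃ C : ℝ≥0, ∀ h : E n → ℝ, MemLp h 2 volume →
      Integrable h volume → ∀ l : ℝ≥0∞, l ≠ 0 → l ≠ ∞ →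
        l * volume {x | l < ‖op T h x‖ₑ} ≤ C * ∫⁻ x, ‖h x‖ₑ := by
  obtain ⟨ε, A, hε, hK⟩ := hT.kernel
  set v : ℝ≥0∞ := volume (ball (0 : E n) 1)
  have hv : v ≠ ∞ := measure_ball_lt_top.ne
  set D : ℝ≥0∞ := ENNReal.ofReal A * (tailConst n ε * v)
  have hD : D ≠ ∞ := ENNReal.mul_ne_top ENNReal.ofReal_ne_top
    (ENNReal.mul_ne_top (tailConst_ne_top n hε) hv)
  set C : ℝ≥0∞ := (2 * n) ^ n * v + 12 * 2 ^ n * ‖T‖ₑ ^ 2 + 4 * D with hCdef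
  have hC : C ≠ ∞ := by
    simp [hCdef, ENNReal.add_eq_top, ENNReal.mul_eq_top, hv, hD]
  refine ⟨C.toNNReal, fun h hm hh l hl hlt => ?_⟩
  rw [ENNReal.coe_toNNReal hC]
  obtain ⟨𝒬, F, b, hvol, hBsum, hb2, hG2, hGsq, hueq, hulim⟩ :=
    exists_calderonZygmund_decomposition hn hm hh hl hlt
  set I := ∫⁻ x, ‖h x‖ₑ with hI
  have hc : 𝒬.Countable := 𝒬.to_countable
  set u : ℕ → E n → ℝ := fun j => ∑ P ∈ F j, badPart h P.1 with hu
  set G : E n → ℝ := h - b with hG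
  have hum : ∀ j, MemLp (u j) 2 volume := fun j => memLp_finsetSum' _ fun P _ => memLp_badPart _ hm
  -- away from the dilated cubes
  set r : Cube n → ℝ := fun P => n * P.side with hr
  have hn0 : (0 : ℝ) < n := by exact_mod_cast hn
  have hr0 : ∀ P, 0 < r P := fun P => mul_pos hn0 P.side_pos
  set U : Set (E n) := ⋃ P ∈ 𝒬, ball P.center (2 * r P) with hU
  have hUm : MeasurableSet U := MeasurableSet.biUnion hc fun P _ => measurableSet_ball
  have hUl : l * volume U ≤ (2 * n) ^ n * v * I := by
    calc _ ≤ l * ∑' P : 𝒬, volume (ball P.1.center (2 * r P)) := by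
          gcongr; exact measure_biUnion_le _ hc _
      _ = ∑' P : 𝒬, (2 * n) ^ n * v * (l * volume P.1.set) := by
          rw [← ENNReal.tsum_mul_left]
          congr 1 with P
          rw [volume_ball_eq _ (mul_pos two_pos (hr0 P)), Cube.volume_set, hr, ← mul_assoc 2,
            mul_pow, ENNReal.ofReal_mul (by positivity), ENNReal.ofReal_pow (by positivity),
            ENNReal.ofReal_mul (by positivity)]
          simp only [ENNReal.ofReal_ofNat, ENNReal.ofReal_natCast]
          ring
      _ ≤ _ := by rw [ENNReal.tsum_mul_left, ENNReal.tsum_mul_left]; gcongr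
  have huU : ∀ j, ∫⁻ x in Uᶜ, ‖op T (u j) x‖ₑ ≤ D * (2 * I) := by
    intro j
    calc _ ≤ ∫⁻ x in Uᶜ, ∑ P ∈ F j, ‖op T (badPart h P) x‖ₑ := by
          refine lintegral_mono_ae (ae_restrict_of_ae ?_)
          filter_upwards [op_sum T (F j) (fun P : 𝒬 => badPart h P) fun P _ =>
            memLp_badPart _ hm] with x hx
          rw [hu, hx, Finset.sum_apply]
          exact enorm_sum_le _ _
      _ = ∑ P ∈ F j, ∫⁻ x in Uᶜ, ‖op T (badPart h P) x‖ₑ :=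
          lintegral_finsetSum' _ fun P _ => (aemeasurable_op T _).enorm.restrict
      _ ≤ ∑ P ∈ F j, D * ∫⁻ x, ‖badPart h P x‖ₑ := by
          refine Finset.sum_le_sum fun P _ => ?_
          refine (lintegral_mono_set (compl_subset_compl.2 (subset_biUnion_of_mem
            (u := fun P : Cube n => ball P.center (2 * r P)) P.2))).trans ?_
          refine lintegral_compl_ball_op_le hn hT hε hK (hr0 P) (memLp_badPart _ hm)
            (integrable_badPart _ hh) (fun x hx => ?_) (integral_badPart _ hh)
          refine badPart_of_notMem fun hxP => hx ?_
          rw [mem_closedBall, dist_eq_norm, hr, mul_div_assoc]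
          exact Cube.norm_sub_center_le hxP
      _ ≤ ∑' P : 𝒬, D * ∫⁻ x, ‖badPart h P x‖ₑ := ENNReal.sum_le_tsum _
      _ ≤ _ := by rw [ENNReal.tsum_mul_left]; gcongr
  have hbU : ∫⁻ x in Uᶜ, ‖op T b x‖ₑ ≤ D * (2 * I) := by
    obtain ⟨ns, _, hns⟩ := exists_subseq_op_tendsto T hb2 (fun j => (hum j).1)
      (fun j => Eventually.of_forall fun x => by
        rcases hueq j x with h | h
        · exact (congrArg _ h).le
        · exact (congrArg _ h).le.trans (by simp)) (Eventually.of_forall hulim)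
    calc _ ≤ ∫⁻ x in Uᶜ, liminf (fun j => ‖op T (u (ns j)) x‖ₑ) atTop := by
          refine lintegral_mono_ae (ae_restrict_of_ae ?_)
          filter_upwards [hns] with x hx
          rw [hx.enorm.liminf_eq]
      _ ≤ liminf (fun j => ∫⁻ x in Uᶜ, ‖op T (u (ns j)) x‖ₑ) atTop :=
          lintegral_liminf_le' fun j => (aemeasurable_op T _).enorm.restrict
      _ ≤ _ := liminf_le_of_le (by isBoundedDefault) fun a ha => by
          obtain ⟨j, hj⟩ := ha.exists
          exact hj.trans (huU _)
  -- the three parts of the level set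
  set SG : Set (E n) := {x | l / 2 ≤ ‖op T G x‖ₑ}
  set Sb : Set (E n) := {x | x ∈ Uᶜ ∧ l / 2 ≤ ‖op T b x‖ₑ}
  have hsub : {x | l < ‖op T h x‖ₑ} ≤ᵐ[volume] (U ∪ SG ∪ Sb : Set (E n)) := by
    have hadd := op_add T hG2 hb2
    rw [hG, sub_add_cancel] at hadd
    filter_upwards [hadd] with x hx
    change l < ‖op T h x‖ₑ → x ∈ U ∪ SG ∪ Sb
    intro hxl
    by_contra hxn
    have h1 : x ∉ U := fun h => hxn (Or.inl (Or.inl h))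
    have h2 : ‖op T (h - b) x‖ₑ < l / 2 := not_le.1 fun h => hxn (Or.inl (Or.inr h))
    have h3 : ‖op T b x‖ₑ < l / 2 := not_le.1 fun h => hxn (Or.inr ⟨h1, h⟩)
    have hlt' : ‖op T h x‖ₑ < l := by
      rw [hx]
      calc _ ≤ ‖op T (h - b) x‖ₑ + ‖op T b x‖ₑ := enorm_add_le _ _
        _ < l / 2 + l / 2 := ENNReal.add_lt_add h2 h3
        _ = l := ENNReal.add_halves l
    exact lt_asymm hxl hlt'
  have hl2 : l / 2 * 2 = l := ENNReal.div_mul_cancel two_ne_zero ENNReal.ofNat_ne_top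
  have hl20 : l / 2 ≠ 0 := by simp [hl]
  have hl2t : l / 2 ≠ ∞ := ENNReal.div_ne_top hlt two_ne_zero
  have hSG : l * volume SG ≤ 12 * 2 ^ n * ‖T‖ₑ ^ 2 * I := by
    have h1 : (l / 2) ^ 2 * volume SG ≤ ‖T‖ₑ ^ 2 * (2 ^ n * l * (3 * I)) :=
      calc _ ≤ (l / 2) ^ 2 * volume {x | (l / 2) ^ 2 ≤ ‖op T G x‖ₑ ^ 2} := by
            refine mul_le_mul' le_rfl (measure_mono fun x hx => ?_)
            have hx' : l / 2 ≤ ‖op T G x‖ₑ := hx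
            exact pow_le_pow_left' hx' 2
        _ ≤ ∫⁻ x, ‖op T G x‖ₑ ^ 2 :=
            mul_meas_ge_le_lintegral₀ ((aemeasurable_op T G).enorm.pow_const _) _
        _ ≤ ‖T‖ₑ ^ 2 * ∫⁻ x, ‖G x‖ₑ ^ 2 := lintegral_op_sq_le T hG2
        _ ≤ _ := by gcongr
    rw [← ENNReal.mul_le_mul_iff_right hl20 hl2t]
    calc l / 2 * (l * volume SG) = 2 * ((l / 2) ^ 2 * volume SG) := by
          conv_lhs => rw [← hl2, ENNReal.mul_div_cancel_right two_ne_zero ENNReal.ofNat_ne_top]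
          ring
      _ ≤ 2 * (‖T‖ₑ ^ 2 * (2 ^ n * l * (3 * I))) := by gcongr
      _ = l / 2 * (12 * 2 ^ n * ‖T‖ₑ ^ 2 * I) := by
          conv_lhs => rw [← hl2]
          ring
  have hSb : l * volume Sb ≤ 4 * D * I := by
    have h1 : l / 2 * volume Sb ≤ D * (2 * I) :=
      calc _ ≤ l / 2 * (volume.restrict Uᶜ) {x | l / 2 ≤ ‖op T b x‖ₑ} := by
            rw [Measure.restrict_apply' hUm.compl]
            refine mul_le_mul' le_rfl ?_
            exact measure_mono fun x hx => ⟨hx.2, hx.1⟩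
        _ ≤ ∫⁻ x in Uᶜ, ‖op T b x‖ₑ :=
            mul_meas_ge_le_lintegral₀ (aemeasurable_op T b).enorm.restrict _
        _ ≤ _ := hbU
    calc l * volume Sb = 2 * (l / 2 * volume Sb) := by
          conv_lhs => rw [← hl2]
          ring
      _ ≤ 2 * (D * (2 * I)) := by gcongr
      _ = _ := by ring
  calc _ ≤ l * (volume U + volume SG + volume Sb) := by
        gcongr
        refine (measure_mono_ae hsub).trans ((measure_union_le _ _).trans ?_)
        gcongr
        exact measure_union_le _ _
    _ = l * volume U + l * volume SG + l * volume Sb := by ring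
    _ ≤ (2 * n) ^ n * v * I + 12 * 2 ^ n * ‖T‖ₑ ^ 2 * I + 4 * D * I := by gcongr
    _ = _ := by rw [hCdef]; ring

/-! ### Localization of a Calderón–Zygmund operator to a cube -/

/-- The enlarged ball attached to a cube. Its radius is twice that of a ball which contains the cube
well inside. -/
def Cube.star (Q : Cube n) : Set (E n) := ball Q.center (2 * (n * Q.side))

/-- The function `f` localized to the enlarged ball of `Q` and normalized to have mean zero. -/
noncomputable def localPart (f : E n → ℝ) (Q : Cube n) : E n → ℝ :=
  Q.star.indicator fun x => f x - ⨍ y in Q.star, f y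

/-- The mean oscillation of `f` on the enlarged ball of `Q`, with values in `[0, ∞]`. -/
noncomputable def starOsc (f : E n → ℝ) (Q : Cube n) : ℝ≥0∞ :=
  (∫⁻ x, ‖localPart f Q x‖ₑ) / volume Q.star

theorem Cube.radius_pos (hn : 1 ≤ n) (Q : Cube n) : 0 < n * Q.side :=
  mul_pos (by exact_mod_cast hn) Q.side_pos

theorem Cube.set_subset_ball (hn : 1 ≤ n) (Q : Cube n) : Q.set ⊆ ball Q.center (n * Q.side) := by
  intro x hx
  rw [mem_ball, dist_eq_norm]
  have := Q.radius_pos hn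
  linarith [Cube.norm_sub_center_le hx]

theorem Cube.measurableSet_star (Q : Cube n) : MeasurableSet Q.star := measurableSet_ball

theorem Cube.volume_star (hn : 1 ≤ n) (Q : Cube n) :
    volume Q.star = (2 * n) ^ n * volume (ball (0 : E n) 1) * volume Q.set := by
  have h0 := Q.radius_pos hn
  have h1 := Q.side_pos
  rw [Cube.star, volume_ball_eq _ (by linarith), Cube.volume_set, ← mul_assoc 2, mul_pow,
    ENNReal.ofReal_mul (by positivity), ENNReal.ofReal_pow (by positivity),
    ENNReal.ofReal_mul (by positivity)]
  simp only [ENNReal.ofReal_ofNat, ENNReal.ofReal_natCast]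
  ring

theorem Cube.volume_star_ne_top (Q : Cube n) : volume Q.star ≠ ∞ := measure_ball_lt_top.ne

theorem Cube.volume_star_ne_zero (hn : 1 ≤ n) (Q : Cube n) : volume Q.star ≠ 0 :=
  (measure_ball_pos _ _ (by linarith [Q.radius_pos hn])).ne'

theorem Cube.star_subset_star (hn : 1 ≤ n) {P Q : Cube n} (hPQ : P.set ⊆ Q.set) (hk : Q.1 < P.1) :
    P.star ⊆ Q.star := by
  have h1 : 2 * P.side ≤ Q.side := by
    have h2 : (2 : ℝ) * P.side = (2 : ℝ) ^ (-P.1 + 1) := by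
      rw [zpow_add_one₀ two_ne_zero, Cube.side, mul_comm]
    rw [h2]
    exact zpow_le_zpow_right₀ one_le_two (by lia)
  refine ball_subset_ball' ?_
  have := Cube.norm_sub_center_le (hPQ P.center_mem)
  rw [dist_eq_norm]
  have hn0 : (0 : ℝ) < n := by exact_mod_cast hn
  have := mul_le_mul_of_nonneg_left h1 hn0.le
  have := Q.radius_pos hn
  linarith

section localPart

variable {f : E n → ℝ}

theorem localPart_of_notMem {Q : Cube n} {x : E n} (hx : x ∉ Q.star) : localPart f Q x = 0 :=
  indicator_of_notMem hx _

theorem Cube.isFiniteMeasure_restrict_star (Q : Cube n) :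
    IsFiniteMeasure (volume.restrict Q.star) :=
  ⟨by simpa using Q.volume_star_ne_top.lt_top⟩

theorem integrableOn_star (hf : MemLp f 2 volume) (Q : Cube n) :
    Integrable f (volume.restrict Q.star) := by
  have := Q.isFiniteMeasure_restrict_star
  exact (hf.restrict _).integrable one_le_two

theorem memLp_localPart (hf : MemLp f 2 volume) (Q : Cube n) : MemLp (localPart f Q) 2 volume := by
  have := Q.isFiniteMeasure_restrict_star
  rw [localPart, memLp_indicator_iff_restrict Q.measurableSet_star]
  exact (hf.restrict _).sub (memLp_const _)

theorem integrable_localPart (hf : MemLp f 2 volume) (Q : Cube n) :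
    Integrable (localPart f Q) volume := by
  have := Q.isFiniteMeasure_restrict_star
  rw [localPart, integrable_indicator_iff Q.measurableSet_star]
  exact (integrableOn_star hf Q).sub (integrable_const _)

theorem hasCompactSupport_indicator_localPart (S : Set (E n)) (Q : Cube n) :
    HasCompactSupport (S.indicator (localPart f Q)) := by
  refine HasCompactSupport.of_support_subset_isCompact
    (isCompact_closedBall Q.center (2 * (n * Q.side))) fun x hx => ?_
  by_contra hx'
  refine hx ?_
  rw [indicator_apply_eq_zero]
  exact fun _ => localPart_of_notMem fun h => hx' (ball_subset_closedBall h)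

theorem lintegral_localPart (hn : 1 ≤ n) (f : E n → ℝ) (Q : Cube n) :
    ∫⁻ x, ‖localPart f Q x‖ₑ = starOsc f Q * volume Q.star :=
  (ENNReal.div_mul_cancel (Q.volume_star_ne_zero hn) Q.volume_star_ne_top).symm

theorem starOsc_ne_top (hn : 1 ≤ n) (hf : MemLp f 2 volume) (Q : Cube n) : starOsc f Q ≠ ∞ :=
  ENNReal.div_ne_top (integrable_localPart hf Q).2.ne (Q.volume_star_ne_zero hn)

end localPart

theorem tsupport_subset_compl_ball {h : E n → ℝ} {x₀ : E n} {r : ℝ}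
    (hz : ∀ x ∈ ball x₀ (2 * r), h x = 0) : tsupport h ⊆ (ball x₀ (2 * r))ᶜ :=
  closure_minimal (fun x hx hxB => hx (hz x hxB)) isOpen_ball.isClosed_compl

theorem IsStandardKernel.enorm_mul_le {K : E n → E n → ℝ} {ε A : ℝ}
    (hK : IsStandardKernel K ε A) (hA : 0 ≤ A) {h : E n → ℝ} {x x₀ : E n} {r : ℝ}
    (hx : x ∈ ball x₀ r) (hz : ∀ x ∈ ball x₀ (2 * r), h x = 0) (y : E n) :
    ‖K x y * h y‖ ≤ A / r ^ n * ‖h y‖ := by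
  by_cases hy : y ∈ ball x₀ (2 * r)
  · simp [hz y hy]
  · have hr : 0 < r := dist_nonneg.trans_lt (mem_ball.1 hx)
    have hxy : r ≤ ‖x - y‖ := by
      rw [mem_ball, not_lt] at hy
      rw [mem_ball] at hx
      rw [← dist_eq_norm]
      linarith [dist_triangle_left y x₀ x, dist_comm x y]
    have hne : x ≠ y := fun h => by simp [h] at hxy; linarith
    rw [norm_mul]
    gcongr
    refine (hK.size x y hne).trans ?_
    gcongr

/-- `T h` is bounded on a ball around which `h` vanishes. -/
theorem ae_enorm_op_le_of_eq_zero {T : L2 n →L[ℝ] L2 n} {K : E n → E n → ℝ} {ε A : ℝ}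
    (hn : 1 ≤ n) (hT : IsCalderonZygmund T K) (hK : IsStandardKernel K ε A) {h : E n → ℝ}
    (hm : MemLp h 2 volume) (hcs : HasCompactSupport h) {x₀ : E n}
    {r : ℝ} (hz : ∀ x ∈ ball x₀ (2 * r), h x = 0) :
    ∀ᵐ x : E n, x ∈ ball x₀ r → ‖op T h x‖ₑ ≤ ENNReal.ofReal (A / r ^ n) * ∫⁻ y, ‖h y‖ₑ := by
  have hA := hK.nonneg hn
  filter_upwards [hT.assoc h hm hcs] with x hx hxB
  have hr : 0 < r := dist_nonneg.trans_lt (mem_ball.1 hxB)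
  rw [op_of_memLp T hm, hx fun hxs => tsupport_subset_compl_ball hz hxs
    (ball_subset_ball (by linarith) hxB)]
  calc _ ≤ ∫⁻ y, ‖K x y * h y‖ₑ := enorm_integral_le_lintegral_enorm _
    _ ≤ ∫⁻ y, ENNReal.ofReal (A / r ^ n) * ‖h y‖ₑ := by
        refine lintegral_mono fun y => ?_
        rw [← ofReal_norm, ← ofReal_norm (h y), ← ENNReal.ofReal_mul (by positivity)]
        exact ENNReal.ofReal_le_ofReal (hK.enorm_mul_le hA hxB hz y)
    _ = _ := lintegral_const_mul' _ _ ENNReal.ofReal_ne_top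

/-- `T h` is nearly constant on a ball around which `h` vanishes. -/
theorem exists_ae_enorm_op_sub_le {T : L2 n →L[ℝ] L2 n} {K : E n → E n → ℝ} {ε A : ℝ}
    (hn : 1 ≤ n) (hT : IsCalderonZygmund T K) (hε : 0 < ε) (hK : IsStandardKernel K ε A)
    {h : E n → ℝ} (hm : MemLp h 2 volume) (hh : Integrable h volume)
    (hcs : HasCompactSupport h) {x₀ : E n} {r : ℝ} (hr : 0 < r)
    (hz : ∀ x ∈ ball x₀ (2 * r), h x = 0)
    {M : ℝ≥0∞} (hM : ∀ R, 2 * r ≤ R → ∫⁻ y in ball x₀ R, ‖h y‖ₑ ≤ M * ENNReal.ofReal (R ^ n)) :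
    ∃ c : ℝ, ∀ᵐ x : E n, x ∈ ball x₀ r →
      ‖op T h x - c‖ₑ ≤ ENNReal.ofReal A * (tailConst n ε * M) := by
  have hA := hK.nonneg hn
  have hint : ∀ x ∈ ball x₀ r, Integrable (fun y => K x y * h y) volume := fun x hx =>
    (hh.norm.const_mul (A / r ^ n)).mono' ((hK.aemeasurable_right hε hn x).aestronglyMeasurable.mul
      hm.1) (Eventually.of_forall fun y => hK.enorm_mul_le hA hx hz y)
  refine ⟨∫ y, K x₀ y * h y, ?_⟩
  filter_upwards [hT.assoc h hm hcs] with x hx hxB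
  rw [op_of_memLp T hm, hx fun hxs => tsupport_subset_compl_ball hz hxs
    (ball_subset_ball (by linarith) hxB), ← integral_sub (hint x hxB) (hint x₀ (mem_ball_self hr))]
  calc _ ≤ ∫⁻ y, ‖K x y * h y - K x₀ y * h y‖ₑ := enorm_integral_le_lintegral_enorm _
    _ = ∫⁻ y in (ball x₀ (2 * r))ᶜ, ‖(K x y - K x₀ y) * h y‖ₑ := by
        rw [← lintegral_indicator measurableSet_ball.compl]
        refine lintegral_congr fun y => ?_
        by_cases hy : y ∈ ball x₀ (2 * r)
        · simp [hz y hy, hy]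
        · rw [indicator_of_mem hy, sub_mul]
    _ ≤ _ := hK.lintegral_sub_mul_le hε hA hxB hm.1.aemeasurable hM

/-- Passing from a cube `Q` to a subcube `P`. The change of the normalizing constant produces a
multiple of `T 1_{P.star}`, which is bounded on `P`. -/
theorem ae_enorm_op_localPart_le {T : L2 n →L[ℝ] L2 n} (hn : 1 ≤ n) {C : ℝ≥0∞}
    (hC : ∀ (x₀ : E n) (r : ℝ), 0 < r → ∀ᵐ x : E n, x ∈ ball x₀ r →
      ‖op T ((ball x₀ (2 * r)).indicator fun _ => 1) x‖ₑ ≤ C)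
    {f : E n → ℝ} (hf : MemLp f 2 volume) {P Q : Cube n} (hPQ : P.set ⊆ Q.set) (hk : Q.1 < P.1)
    {κ : ℝ≥0∞}
    (h1 : ∀ᵐ x : E n, x ∈ P.set → ‖op T (P.starᶜ.indicator (localPart f Q)) x‖ₑ ≤ κ)
    (h2 : ∫⁻ x in P.star, ‖localPart f Q x‖ₑ ≤ κ * volume P.star) :
    ∀ᵐ x : E n, x ∈ P.set →
      ‖op T (localPart f Q) x‖ₑ ≤ ‖op T (localPart f P) x‖ₑ + (1 + C) * κ := by
  have hsub := Cube.star_subset_star hn hPQ hk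
  set cQ := ⨍ y in Q.star, f y with hcQ
  set cP := ⨍ y in P.star, f y with hcP
  have hP0 := P.volume_star_ne_zero hn
  have hPt := P.volume_star_ne_top
  have := P.isFiniteMeasure_restrict_star
  have hc : ‖cP - cQ‖ₑ ≤ κ := by
    have e : cP - cQ = ⨍ y in P.star, (f y - cQ) := by
      rw [setAverage_eq, integral_sub (integrableOn_star hf P) (integrable_const _), smul_sub,
        ← setAverage_eq, ← setAverage_eq, setAverage_const hP0 hPt]
    rw [← ENNReal.mul_le_mul_iff_left hP0 hPt, e]
    refine (enorm_setAverage_mul_le _ hP0 hPt).trans (le_trans (le_of_eq ?_) h2)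
    refine setLIntegral_congr_fun P.measurableSet_star fun y hy => ?_
    simp only [localPart, indicator_of_mem (hsub hy), hcQ]
  have hmi : MemLp (P.star.indicator fun _ => (1 : ℝ)) 2 volume :=
    memLp_indicator_const 2 P.measurableSet_star 1 (Or.inr hPt)
  have hm1 : MemLp (P.starᶜ.indicator (localPart f Q)) 2 volume :=
    (memLp_localPart hf Q).indicator P.measurableSet_star.compl
  have hdec : localPart f Q = P.starᶜ.indicator (localPart f Q) +
      (localPart f P + (cP - cQ) • P.star.indicator fun _ => (1 : ℝ)) := by
    funext x
    by_cases hx : x ∈ P.star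
    · simp [localPart, hx, hsub hx, ← hcP, ← hcQ]
    · simp [localPart, hx]
  have ha1 := op_add T hm1 ((memLp_localPart hf P).add (hmi.const_smul (cP - cQ)))
  rw [← hdec] at ha1
  filter_upwards [ha1, op_add T (memLp_localPart hf P) (hmi.const_smul (cP - cQ)),
    op_smul T (cP - cQ) hmi, h1, hC P.center _ (P.radius_pos hn)] with x e1 e2 e3 hx1 hx2 hxP
  rw [e1, Pi.add_apply, e2, Pi.add_apply, e3, Pi.smul_apply, smul_eq_mul]
  calc _ ≤ ‖op T (P.starᶜ.indicator (localPart f Q)) x‖ₑ + (‖op T (localPart f P) x‖ₑ +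
        ‖(cP - cQ) * op T (P.star.indicator fun _ => 1) x‖ₑ) :=
        (enorm_add_le _ _).trans (by gcongr; exact enorm_add_le _ _)
    _ ≤ κ + (‖op T (localPart f P) x‖ₑ + κ * C) := by
        rw [enorm_mul]
        gcongr
        · exact hx1 hxP
        · exact hx2 (P.set_subset_ball hn hxP)
    _ = _ := by ring

/-- The passage from a cube to one of its children. -/
theorem exists_ae_enorm_op_localPart_le_of_child {T : L2 n →L[ℝ] L2 n} {K : E n → E n → ℝ}
    (hn : 1 ≤ n) (hT : IsCalderonZygmund T K) (h1 : EqInBMO T K (fun _ => 1) (fun _ => 0)) :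
    ∃ C : ℝ≥0, ∀ f : E n → ℝ, MemLp f 2 volume → ∀ P : Cube n,
      ∀ᵐ x : E n, x ∈ P.set → ‖op T (localPart f P.parent) x‖ₑ ≤
        ‖op T (localPart f P) x‖ₑ + C * starOsc f P.parent := by
  obtain ⟨C₁, hC₁⟩ := exists_forall_enorm_op_indicator_ball_le hn hT h1
  obtain ⟨ε, A, hε, hK⟩ := hT.kernel
  have hA := hK.nonneg hn
  set v : ℝ≥0∞ := volume (ball (0 : E n) 1)
  have hv : v ≠ ∞ := measure_ball_lt_top.ne
  set κ : ℝ≥0∞ := ENNReal.ofReal A * (4 ^ n * v) + 2 ^ n with hκ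
  have hC : (1 + C₁) * κ ≠ ∞ := by
    simp [hκ, ENNReal.add_eq_top, ENNReal.mul_eq_top, hv]
  refine ⟨((1 + C₁) * κ).toNNReal, fun f hf P => ?_⟩
  rw [ENNReal.coe_toNNReal hC, mul_assoc]
  have hr := P.radius_pos hn
  have hvol : volume P.parent.star = 2 ^ n * volume P.star := by
    rw [Cube.volume_star hn, Cube.volume_star hn, P.volume_parent]; ring
  refine ae_enorm_op_localPart_le hn hC₁ hf P.subset_parent
    (by simp [Cube.parent, Cube.containing]) ?_ ?_
  · have hm1 : MemLp (P.starᶜ.indicator (localPart f P.parent)) 2 volume :=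
      (memLp_localPart hf _).indicator P.measurableSet_star.compl
    filter_upwards [ae_enorm_op_le_of_eq_zero hn hT hK hm1
      (hasCompactSupport_indicator_localPart _ _) (x₀ := P.center) (r := n * P.side)
      (fun x hx => indicator_of_notMem (notMem_compl_iff.2 hx) _)] with x hx hxP
    refine (hx (P.set_subset_ball hn hxP)).trans ?_
    calc _ ≤ ENNReal.ofReal (A / (n * P.side) ^ n) * ∫⁻ y, ‖localPart f P.parent y‖ₑ := by
          gcongr with y
          exact enorm_indicator_le_enorm_self _ _
      _ = ENNReal.ofReal (A / (n * P.side) ^ n * (2 ^ n * (2 * (n * P.side)) ^ n)) * v *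
            starOsc f P.parent := by
          rw [lintegral_localPart hn, hvol, Cube.star, volume_ball_eq _ (by positivity),
            ENNReal.ofReal_mul (p := A / _) (by positivity), ENNReal.ofReal_mul (by positivity),
            ENNReal.ofReal_pow zero_le_two, ENNReal.ofReal_ofNat]
          ring
      _ = ENNReal.ofReal A * (4 ^ n * v) * starOsc f P.parent := by
          have e : A / (n * P.side) ^ n * (2 ^ n * (2 * (n * P.side)) ^ n) = A * 4 ^ n := by
            rw [mul_pow 2, ← mul_assoc (2 ^ n), ← mul_pow]
            field_simp
            norm_num
          rw [e, ENNReal.ofReal_mul hA, ENNReal.ofReal_pow (by norm_num), ENNReal.ofReal_ofNat]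
          ring
      _ ≤ κ * starOsc f P.parent := by gcongr; exact le_self_add
  · calc _ ≤ ∫⁻ x, ‖localPart f P.parent x‖ₑ := setLIntegral_le_lintegral _ _
      _ = 2 ^ n * starOsc f P.parent * volume P.star := by
          rw [lintegral_localPart hn, hvol]; ring
      _ ≤ _ := by gcongr; exact le_add_self

/-! ### Stopping cubes -/

/-- Maximal cubes in which a small subset of `Q` has density larger than `2⁻ⁿ⁻¹`. -/
theorem exists_density_cubes (hn : 1 ≤ n) (Q : Cube n) {Ω : Set (E n)} (hΩm : MeasurableSet Ω)
    (hΩQ : Ω ⊆ Q.set) (hΩ : 2 ^ (n + 3) * volume Ω ≤ volume Q.set) :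
    ∃ 𝒬 : Set (Cube n), 𝒬.PairwiseDisjoint Cube.set ∧
      (∀ P ∈ 𝒬, Q.1 < P.1 ∧ P.set ⊆ Q.set) ∧
      4 * volume (⋃ P ∈ 𝒬, P.set) ≤ volume Q.set ∧
      (∀ P ∈ 𝒬, 2 * volume (P.set ∩ Ω) ≤ volume P.set) ∧
      ∀ᵐ x : E n, (∀ P ∈ 𝒬, x ∉ P.set) → x ∉ Ω := by
  have hΩt : volume Ω ≠ ∞ := ((measure_mono hΩQ).trans_lt Q.volume_set_ne_top.lt_top).ne
  set h : E n → ℝ := Ω.indicator fun _ => 1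
  have hh : Integrable h volume := (integrable_indicator_iff hΩm).2 (integrableOn_const hΩt)
  have hint : ∀ P : Cube n, ∫⁻ y in P.set, ‖h y‖ₑ = volume (P.set ∩ Ω) := by
    intro P
    simp only [h, enorm_indicator_eq_indicator_enorm, enorm_one]
    rw [lintegral_indicator hΩm, setLIntegral_one, Measure.restrict_apply hΩm, inter_comm]
  have hp0 : (2 : ℝ≥0∞) ^ (n + 1) ≠ 0 := by simp
  have hpt : (2 : ℝ≥0∞) ^ (n + 1) ≠ ∞ := by simp
  obtain ⟨𝒬, hd, hlow, hup, hout⟩ := exists_maximal_cubes hn hh (l := (2 ^ (n + 1))⁻¹)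
    (ENNReal.inv_ne_zero.2 hpt) (ENNReal.inv_ne_top.2 hp0)
  simp only [hint] at hlow hup
  have hlow' : ∀ P ∈ 𝒬, volume P.set < 2 ^ (n + 1) * volume (P.set ∩ Ω) := fun P hP => by
    have := hlow P hP
    rwa [mul_comm, ← div_eq_mul_inv, ENNReal.div_lt_iff (Or.inl hp0) (Or.inl hpt), mul_comm] at this
  have hc : 𝒬.Countable := 𝒬.to_countable
  refine ⟨𝒬, hd, fun P hP => ?_, ?_, fun P hP => ?_, ?_⟩
  · have hne : (P.set ∩ Ω).Nonempty := by
      by_contra hne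
      rw [not_nonempty_iff_eq_empty] at hne
      have := hlow' P hP
      simp [hne] at this
    obtain ⟨x, hxP, hxΩ⟩ := hne
    have hlt : Q.1 < P.1 := by
      by_contra! hle
      have hQP : Q.set ⊆ P.set := Cube.subset_of_mem hle (hΩQ hxΩ) hxP
      have h1 : volume P.set < volume P.set :=
        calc volume P.set < 2 ^ (n + 1) * volume (P.set ∩ Ω) := hlow' P hP
          _ ≤ 2 ^ (n + 3) * volume Ω := by
            gcongr
            · exact one_le_two
            · lia
            · exact inter_subset_right
          _ ≤ volume Q.set := hΩ
          _ ≤ volume P.set := measure_mono hQP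
      exact lt_irrefl _ h1
    exact ⟨hlt, Cube.subset_of_mem hlt.le hxP (hΩQ hxΩ)⟩
  · calc _ = 4 * ∑' P : 𝒬, volume P.1.set := by
          rw [measure_biUnion hc hd fun P _ => P.measurableSet_set]
      _ ≤ 4 * ∑' P : 𝒬, 2 ^ (n + 1) * volume (P.1.set ∩ Ω) :=
          mul_le_mul' le_rfl (ENNReal.tsum_le_tsum fun P => (hlow' P.1 P.2).le)
      _ = 2 ^ (n + 3) * volume (⋃ P ∈ 𝒬, P.set ∩ Ω) := by
          rw [ENNReal.tsum_mul_left, measure_biUnion hc (hd.mono fun P => inter_subset_left)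
            fun P _ => P.measurableSet_set.inter hΩm, ← mul_assoc]
          congr 1
          rw [pow_add, pow_add 2 n 3]
          ring
      _ ≤ 2 ^ (n + 3) * volume Ω := by
          gcongr
          exact iUnion₂_subset fun P _ => inter_subset_right
      _ ≤ _ := hΩ
  · have h1 := hup P hP P.parent (by simp [Cube.parent, Cube.containing]) P.subset_parent
    rw [mul_comm, ← div_eq_mul_inv, ENNReal.le_div_iff_mul_le (Or.inl hp0) (Or.inl hpt),
      P.volume_parent, pow_succ, mul_comm, mul_assoc] at h1
    have h2 := (ENNReal.mul_le_mul_iff_right (by simp) (by simp)).1 h1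
    exact le_trans (by gcongr; exact P.subset_parent) h2
  · filter_upwards [hout] with x hx hxP hxΩ
    have := hx hxP
    simp only [h, indicator_of_mem hxΩ, enorm_one] at this
    rw [ENNReal.one_le_inv] at this
    exact absurd this (not_le.2 (one_lt_pow₀ (ENNReal.one_lt_two) (by lia)))

/-- On a cube `P` which has a large part where the maximal function and the operator are under
control, the contribution to `T g` from outside `P.star` is bounded: it is nearly constant on `P`,
and the weak type bound for the contribution from `P.star` provides a point where it is small. -/
theorem ae_enorm_op_compl_star_le {T : L2 n →L[ℝ] L2 n} {K : E n → E n → ℝ} {ε A : ℝ}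
    (hn : 1 ≤ n) (hT : IsCalderonZygmund T K) (hε : 0 < ε) (hK : IsStandardKernel K ε A)
    {C : ℝ≥0} (hC : ∀ h : E n → ℝ, MemLp h 2 volume →
      Integrable h volume → ∀ l : ℝ≥0∞, l ≠ 0 → l ≠ ∞ →
        l * volume {x | l < ‖op T h x‖ₑ} ≤ C * ∫⁻ x, ‖h x‖ₑ)
    {f : E n → ℝ} (hf : MemLp f 2 volume) {P Q : Cube n} {Ω : Set (E n)}
    (hPΩ : 2 * volume (P.set ∩ Ω) ≤ volume P.set) {l : ℝ≥0∞} (hl : l ≠ 0) (hlt : l ≠ ∞)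
    (hmax : ∀ x ∈ P.set, x ∉ Ω → ∀ R : ℝ, 0 < R →
      ∫⁻ y in closedBall x R, ‖localPart f Q y‖ₑ ≤ l * ENNReal.ofReal (R ^ n))
    (hop : ∀ x ∈ P.set, x ∉ Ω → ‖op T (localPart f Q) x‖ₑ ≤ l) :
    (∀ᵐ x : E n, x ∈ P.set → ‖op T (P.starᶜ.indicator (localPart f Q)) x‖ₑ ≤
      (1 + 4 * (C * 2 ^ n * (2 * n) ^ n + 1) +
        2 * (ENNReal.ofReal A * (tailConst n ε * 2 ^ n))) * l) ∧
    ∫⁻ y in P.star, ‖localPart f Q y‖ₑ ≤ 2 ^ n * (2 * n) ^ n * l * volume P.set := by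
  have hr := P.radius_pos hn
  have hs := P.side_pos
  set r := n * P.side with hrdef
  have hv0 := P.volume_set_ne_zero
  have hvt := P.volume_set_ne_top
  set g := localPart f Q with hg
  -- averages of `g` over balls around the center of `P`
  have hgood : ∃ x ∈ P.set, x ∉ Ω := by
    by_contra! hall
    rw [inter_eq_left.2 hall, two_mul] at hPΩ
    exact absurd hPΩ (not_le.2 (ENNReal.lt_add_right hvt hv0))
  have hball : ∀ R, 2 * r ≤ R → ∫⁻ y in ball P.center R, ‖g y‖ₑ ≤
      2 ^ n * l * ENNReal.ofReal (R ^ n) := by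
    intro R hR
    obtain ⟨x, hxP, hxΩ⟩ := hgood
    have hd := Cube.norm_sub_center_le hxP
    calc _ ≤ ∫⁻ y in closedBall x (2 * R), ‖g y‖ₑ := by
          refine lintegral_mono_set (ball_subset_closedBall.trans
            (closedBall_subset_closedBall' ?_))
          rw [dist_comm, dist_eq_norm]
          linarith
      _ ≤ l * ENNReal.ofReal ((2 * R) ^ n) := hmax x hxP hxΩ _ (by linarith)
      _ = _ := by
          rw [mul_pow, ENNReal.ofReal_mul (by positivity), ENNReal.ofReal_pow zero_le_two,
            ENNReal.ofReal_ofNat]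
          ring
  have hstar : ∫⁻ y in P.star, ‖g y‖ₑ ≤ 2 ^ n * (2 * n) ^ n * l * volume P.set := by
    refine (hball _ le_rfl).trans (le_of_eq ?_)
    rw [Cube.volume_set, hrdef, ← mul_assoc 2, mul_pow,
      ENNReal.ofReal_mul (by positivity), ENNReal.ofReal_pow (by positivity),
      ENNReal.ofReal_mul (by positivity)]
    simp only [ENNReal.ofReal_ofNat, ENNReal.ofReal_natCast]
    ring
  refine ⟨?_, hstar⟩
  have hgm : MemLp g 2 volume := memLp_localPart hf Q
  have hgi : Integrable g volume := integrable_localPart hf Q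
  have hm1 : MemLp (P.starᶜ.indicator g) 2 volume := hgm.indicator P.measurableSet_star.compl
  have hm2 : MemLp (P.star.indicator g) 2 volume := hgm.indicator P.measurableSet_star
  set D : ℝ≥0∞ := ENNReal.ofReal A * (tailConst n ε * (2 ^ n * l)) with hD
  obtain ⟨c, hc⟩ := exists_ae_enorm_op_sub_le hn hT hε hK hm1
    (hgi.indicator P.measurableSet_star.compl) (hasCompactSupport_indicator_localPart _ _) hr
    (fun x hx => indicator_of_notMem (notMem_compl_iff.2 hx) _) (M := 2 ^ n * l) (fun R hR =>
      (lintegral_mono fun y => enorm_indicator_le_enorm_self _ _).trans (hball R hR))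
  -- the contribution from `P.star`
  set D₁ : ℝ≥0∞ := C * 2 ^ n * (2 * n) ^ n with hD₁
  have hD₁t : D₁ ≠ ∞ := by simp [hD₁, ENNReal.mul_eq_top]
  set b : ℝ≥0∞ := 4 * (D₁ + 1) with hb
  have hbt : b ≠ ∞ := ENNReal.mul_ne_top (by simp) (by simp [hD₁t])
  have hweak : 4 * volume {x | b * l < ‖op T (P.star.indicator g) x‖ₑ} ≤ volume P.set := by
    have h1 := hC _ hm2 (hgi.indicator P.measurableSet_star) (b * l)
      (mul_ne_zero (by simp [hb]) hl) (ENNReal.mul_ne_top hbt hlt)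
    set W := volume {x | b * l < ‖op T (P.star.indicator g) x‖ₑ}
    have h2 : ∫⁻ x, ‖P.star.indicator g x‖ₑ ≤ 2 ^ n * (2 * n) ^ n * l * volume P.set := by
      refine le_trans (le_of_eq ?_) hstar
      simp only [enorm_indicator_eq_indicator_enorm]
      exact lintegral_indicator P.measurableSet_star _
    have h3 : (D₁ + 1) * l ≠ 0 := mul_ne_zero (by simp) hl
    have h4 : (D₁ + 1) * l ≠ ∞ := ENNReal.mul_ne_top (by simp [hD₁t]) hlt
    rw [← ENNReal.mul_le_mul_iff_right h3 h4]
    calc (D₁ + 1) * l * (4 * W) = b * l * W := by rw [hb]; ring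
      _ ≤ C * (2 ^ n * (2 * n) ^ n * l * volume P.set) := h1.trans (by gcongr)
      _ = D₁ * l * volume P.set := by rw [hD₁]; ring
      _ ≤ _ := by gcongr; exact le_self_add
  have hcl : ‖c‖ₑ ≤ D + l + b * l := by
    have hadd := op_add T hm1 hm2
    rw [indicator_compl_add_self] at hadd
    set N : Set (E n) := {x | ¬ (op T g x =
      (op T (P.starᶜ.indicator g) + op T (P.star.indicator g)) x ∧
      (x ∈ ball P.center r → ‖op T (P.starᶜ.indicator g) x - c‖ₑ ≤ D))}
    have hN : volume N = 0 := hadd.and hc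
    have hex : ∃ x ∈ P.set, x ∉ Ω ∧ ¬ b * l < ‖op T (P.star.indicator g) x‖ₑ ∧ x ∉ N := by
      by_contra! hall
      have hsub : P.set ⊆ P.set ∩ Ω ∪ {x | b * l < ‖op T (P.star.indicator g) x‖ₑ} ∪ N := by
        intro x hx
        by_cases h1 : x ∈ Ω
        · exact Or.inl (Or.inl ⟨hx, h1⟩)
        by_cases h2 : b * l < ‖op T (P.star.indicator g) x‖ₑ
        · exact Or.inl (Or.inr h2)
        · exact Or.inr (hall x hx h1 (not_lt.1 h2))
      have h5 := (measure_mono (μ := volume) hsub).trans ((measure_union_le _ _).trans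
        (add_le_add (measure_union_le _ _) le_rfl))
      rw [hN, add_zero] at h5
      have h6 : 4 * volume P.set ≤ 3 * volume P.set :=
        calc _ ≤ 2 * (2 * volume (P.set ∩ Ω)) +
              4 * volume {x | b * l < ‖op T (P.star.indicator g) x‖ₑ} := by
              refine (mul_le_mul' le_rfl h5).trans (le_of_eq ?_)
              ring
          _ ≤ 2 * volume P.set + volume P.set := by gcongr
          _ = _ := by ring
      rw [ENNReal.mul_le_mul_iff_left hv0 hvt] at h6
      norm_num at h6
    obtain ⟨x, hxP, hxΩ, hxb, hxN⟩ := hex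
    obtain ⟨e, hx⟩ := not_not.1 hxN
    have hx' := hx (P.set_subset_ball hn hxP)
    rw [Pi.add_apply] at e
    have ec : c = -(op T (P.starᶜ.indicator g) x - c) +
        (op T g x - op T (P.star.indicator g) x) := by
      rw [e]; ring
    rw [ec]
    refine (enorm_add_le _ _).trans ?_
    rw [enorm_neg, add_assoc]
    gcongr
    exact enorm_sub_le.trans (add_le_add (hop x hxP hxΩ) (not_lt.1 hxb))
  filter_upwards [hc] with x hx hxP
  have hx' := hx (P.set_subset_ball hn hxP)
  have e : op T (P.starᶜ.indicator g) x = (op T (P.starᶜ.indicator g) x - c) + c := by ring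
  rw [e]
  calc _ ≤ D + (D + l + b * l) := (enorm_add_le _ _).trans (add_le_add hx' hcl)
    _ = _ := by rw [hD, hb]; ring

/-- The set where the maximal function of `localPart f Q` or `T (localPart f Q)` is large compared
to the mean oscillation is a small part of `Q`. -/
theorem exists_exceptional_set {T : L2 n →L[ℝ] L2 n} {K : E n → E n → ℝ}
    (hn : 1 ≤ n) (hT : IsCalderonZygmund T K) :
    ∃ a : ℝ≥0, a ≠ 0 ∧ ∀ f : E n → ℝ, MemLp f 2 volume → ∀ Q : Cube n, starOsc f Q ≠ 0 →
      ∃ Ω : Set (E n), MeasurableSet Ω ∧ Ω ⊆ Q.set ∧ 2 ^ (n + 3) * volume Ω ≤ volume Q.set ∧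
        ∀ x ∈ Q.set, x ∉ Ω → ‖op T (localPart f Q) x‖ₑ ≤ a * starOsc f Q ∧
          ∀ R : ℝ, 0 < R → ∫⁻ y in closedBall x R, ‖localPart f Q y‖ₑ ≤
            a * starOsc f Q * ENNReal.ofReal (R ^ n) := by
  obtain ⟨C, hC⟩ := exists_mul_volume_op_le hn hT
  set v : ℝ≥0∞ := volume (ball (0 : E n) 1)
  have hv : v ≠ ∞ := measure_ball_lt_top.ne
  have hv0 : v ≠ 0 := (measure_ball_pos _ _ one_pos).ne'
  set D : ℝ≥0∞ := (4 ^ n * v + C) * ((2 * n) ^ n * v) with hD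
  have hDt : D ≠ ∞ := by simp [hD, ENNReal.mul_eq_top, ENNReal.add_eq_top, hv]
  have hD0 : D ≠ 0 := by
    have : n ≠ 0 := by lia
    simp [hD, hv0, this]
  have hat : D * 2 ^ (n + 3) ≠ ∞ := ENNReal.mul_ne_top hDt (by simp)
  have ha0 : D * 2 ^ (n + 3) ≠ 0 := mul_ne_zero hD0 (by simp)
  refine ⟨(D * 2 ^ (n + 3)).toNNReal, fun h =>
    ((ENNReal.toNNReal_eq_zero_iff _).1 h).elim ha0 hat, fun f hf Q hQ => ?_⟩
  rw [ENNReal.coe_toNNReal hat]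
  set a := D * 2 ^ (n + 3) with ha
  set ω := starOsc f Q with hω
  have hωt : ω ≠ ∞ := starOsc_ne_top hn hf Q
  set g := localPart f Q
  set I := ∫⁻ x, ‖g x‖ₑ with hI
  have hIω : I = ω * ((2 * n) ^ n * v * volume Q.set) := by
    rw [hI, lintegral_localPart hn, Cube.volume_star hn]
  have hIt : I ≠ ∞ := (integrable_localPart hf Q).2.ne
  have hl0 : a * ω ≠ 0 := mul_ne_zero ha0 hQ
  have hlt : a * ω ≠ ∞ := ENNReal.mul_ne_top hat hωt
  set S₁ : Set (E n) := {x | ∃ R : ℝ, 0 < R ∧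
    a * ω * ENNReal.ofReal (R ^ n) < ∫⁻ y in closedBall x R, ‖g y‖ₑ} with hS₁
  set S₂ : Set (E n) := {x | a * ω < ‖op T g x‖ₑ} with hS₂
  have h1 : a * ω * volume S₁ ≤ 4 ^ n * v * I := mul_volume_maximal_le hn hIt hl0 hlt
  have h2 : a * ω * volume S₂ ≤ C * I :=
    hC g (memLp_localPart hf Q) (integrable_localPart hf Q) _ hl0 hlt
  refine ⟨toMeasurable volume (S₁ ∪ S₂) ∩ Q.set,
    (measurableSet_toMeasurable _ _).inter Q.measurableSet_set, inter_subset_right, ?_, ?_⟩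
  · calc _ ≤ 2 ^ (n + 3) * (volume S₁ + volume S₂) := by
          gcongr
          refine (measure_mono inter_subset_left).trans ?_
          rw [measure_toMeasurable]
          exact measure_union_le _ _
      _ ≤ volume Q.set := by
          rw [← ENNReal.mul_le_mul_iff_right (mul_ne_zero hD0 hQ) (ENNReal.mul_ne_top hDt hωt)]
          calc _ = a * ω * volume S₁ + a * ω * volume S₂ := by rw [ha]; ring
            _ ≤ 4 ^ n * v * I + C * I := add_le_add h1 h2
            _ = _ := by rw [hIω, hD]; ring
  · intro x hxQ hxΩ
    have hx : x ∉ S₁ ∪ S₂ := fun h => hxΩ ⟨subset_toMeasurable _ _ h, hxQ⟩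
    refine ⟨not_lt.1 fun h => hx (Or.inr h), fun R hR => not_lt.1 fun h => hx (Or.inl ⟨R, hR, h⟩)⟩

/-- One generation of the stopping time construction. -/
theorem exists_stopping_cubes {T : L2 n →L[ℝ] L2 n} {K : E n → E n → ℝ}
    (hn : 1 ≤ n) (hT : IsCalderonZygmund T K) (h1 : EqInBMO T K (fun _ => 1) (fun _ => 0)) :
    ∃ C : ℝ≥0, ∀ f : E n → ℝ, MemLp f 2 volume → ∀ Q : Cube n,
      ∃ 𝒬 : Set (Cube n), 𝒬.PairwiseDisjoint Cube.set ∧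
        (∀ P ∈ 𝒬, Q.1 < P.1 ∧ P.set ⊆ Q.set) ∧
        4 * volume (⋃ P ∈ 𝒬, P.set) ≤ volume Q.set ∧
        (∀ᵐ x : E n, x ∈ Q.set → (∀ P ∈ 𝒬, x ∉ P.set) →
          ‖op T (localPart f Q) x‖ₑ ≤ C * starOsc f Q) ∧
        ∀ P ∈ 𝒬, ∀ᵐ x : E n, x ∈ P.set →
          ‖op T (localPart f Q) x‖ₑ ≤ ‖op T (localPart f P) x‖ₑ + C * starOsc f Q := by
  obtain ⟨C₁, hC₁⟩ := exists_forall_enorm_op_indicator_ball_le hn hT h1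
  obtain ⟨C₂, hC₂⟩ := exists_mul_volume_op_le hn hT
  obtain ⟨a, ha0, ha⟩ := exists_exceptional_set hn hT
  obtain ⟨ε, A, hε, hK⟩ := hT.kernel
  set v : ℝ≥0∞ := volume (ball (0 : E n) 1) with hvdef
  have hv : v ≠ ∞ := measure_ball_lt_top.ne
  have hv0 : v ≠ 0 := (measure_ball_pos _ _ one_pos).ne'
  set κ₁ : ℝ≥0∞ := 1 + 4 * (C₂ * 2 ^ n * (2 * n) ^ n + 1) +
    2 * (ENNReal.ofReal A * (tailConst n ε * 2 ^ n)) with hκ₁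
  set κ : ℝ≥0∞ := κ₁ + 2 ^ n * v⁻¹ with hκ
  set B : ℝ≥0∞ := a + (1 + C₁) * (κ * a) with hB
  have hBt : B ≠ ∞ := by
    simp [hB, hκ, hκ₁, ENNReal.mul_eq_top, ENNReal.add_eq_top, hv0, tailConst_ne_top n hε]
  refine ⟨B.toNNReal, fun f hf Q => ?_⟩
  rw [ENNReal.coe_toNNReal hBt]
  by_cases hω : starOsc f Q = 0
  · -- here `f` is constant on `Q.star`, and no cube is selected
    refine ⟨∅, pairwiseDisjoint_empty, by simp, by simp, ?_, by simp⟩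
    have h0 : localPart f Q =ᵐ[volume] 0 := by
      have := lintegral_localPart hn f Q
      rw [hω, zero_mul, lintegral_eq_zero_iff' (memLp_localPart hf Q).1.aemeasurable.enorm] at this
      filter_upwards [this] with x hx
      simpa using hx
    filter_upwards [op_zero_ae T h0] with x hx _ _
    simp [hx]
  obtain ⟨Ω, hΩm, hΩQ, hΩ, hΩx⟩ := ha f hf Q hω
  obtain ⟨𝒬, hd, hsub, hvol, hhalf, hout⟩ := exists_density_cubes hn Q hΩm hΩQ hΩ
  refine ⟨𝒬, hd, hsub, hvol, ?_, fun P hP => ?_⟩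
  · filter_upwards [hout] with x hx hxQ hxP
    refine ((hΩx x hxQ (hx hxP)).1).trans ?_
    gcongr
    exact le_self_add
  · have hωt : starOsc f Q ≠ ∞ := starOsc_ne_top hn hf Q
    have hPQ := (hsub P hP).2
    obtain ⟨k1, k2⟩ := ae_enorm_op_compl_star_le hn hT hε hK hC₂ hf (P := P) (Q := Q) (hhalf P hP)
      (mul_ne_zero (by simpa using ha0) hω) (ENNReal.mul_ne_top (by simp) hωt)
      (fun x hx hxΩ => (hΩx x (hPQ hx) hxΩ).2) (fun x hx hxΩ => (hΩx x (hPQ hx) hxΩ).1)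
    have k3 := ae_enorm_op_localPart_le hn hC₁ hf hPQ (hsub P hP).1 (κ := κ * (a * starOsc f Q))
      (k1.mono fun x hx hxP => (hx hxP).trans (by gcongr; exact le_self_add))
      (k2.trans (by
        rw [Cube.volume_star hn]
        calc _ = 2 ^ n * (v⁻¹ * v) * (2 * n) ^ n * (a * starOsc f Q) * volume P.set := by
              rw [ENNReal.inv_mul_cancel hv0 hv, mul_one]
          _ = 2 ^ n * v⁻¹ * (a * starOsc f Q) * ((2 * n) ^ n * v * volume P.set) := by ring
          _ ≤ _ := by gcongr; exact le_add_self))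
    filter_upwards [k3] with x hx hxP
    refine (hx hxP).trans (add_le_add le_rfl ?_)
    calc _ = (1 + C₁) * (κ * a) * starOsc f Q := by ring
      _ ≤ _ := by gcongr; exact le_add_self

/-- A stopping rule on the whole grid that contains the chain of cubes around the origin, so that
the trees grown from the cubes `Cube.top N` increase with `N`. -/
theorem exists_stopping_rule {T : L2 n →L[ℝ] L2 n} {K : E n → E n → ℝ}
    (hn : 1 ≤ n) (hT : IsCalderonZygmund T K) (h1 : EqInBMO T K (fun _ => 1) (fun _ => 0)) :
    ∃ C : ℝ≥0, ∀ f : E n → ℝ, MemLp f 2 volume → ∃ sel : Cube n → Set (Cube n),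
      (∀ N, Cube.top N ∈ sel (Cube.top (N + 1))) ∧
      ∀ Q : Cube n, (sel Q).PairwiseDisjoint Cube.set ∧
        (∀ P ∈ sel Q, Q.1 < P.1 ∧ P.set ⊆ Q.set) ∧
        4 * volume (⋃ P ∈ sel Q, P.set) ≤ 3 * volume Q.set ∧
        (∀ᵐ x : E n, x ∈ Q.set → (∀ P ∈ sel Q, x ∉ P.set) →
          ‖op T (localPart f Q) x‖ₑ ≤ C * starOsc f Q) ∧
        ∀ P ∈ sel Q, ∀ᵐ x : E n, x ∈ P.set →
          ‖op T (localPart f Q) x‖ₑ ≤ ‖op T (localPart f P) x‖ₑ + C * starOsc f Q := by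
  obtain ⟨C₁, hC₁⟩ := exists_stopping_cubes hn hT h1
  obtain ⟨C₂, hC₂⟩ := exists_ae_enorm_op_localPart_le_of_child hn hT h1
  refine ⟨C₁ + C₂, fun f hf => ?_⟩
  have key : ∀ Q : Cube n, ∃ 𝒬 : Set (Cube n),
      (∀ N, Q = Cube.top (N + 1) → Cube.top N ∈ 𝒬) ∧ 𝒬.PairwiseDisjoint Cube.set ∧
        (∀ P ∈ 𝒬, Q.1 < P.1 ∧ P.set ⊆ Q.set) ∧
        4 * volume (⋃ P ∈ 𝒬, P.set) ≤ 3 * volume Q.set ∧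
        (∀ᵐ x : E n, x ∈ Q.set → (∀ P ∈ 𝒬, x ∉ P.set) →
          ‖op T (localPart f Q) x‖ₑ ≤ (C₁ + C₂ : ℝ≥0) * starOsc f Q) ∧
        ∀ P ∈ 𝒬, ∀ᵐ x : E n, x ∈ P.set →
          ‖op T (localPart f Q) x‖ₑ ≤
            ‖op T (localPart f P) x‖ₑ + (C₁ + C₂ : ℝ≥0) * starOsc f Q := by
    intro Q
    obtain ⟨𝒬, hd, hsub, hvol, hout, htr⟩ := hC₁ f hf Q
    have hle₁ : (C₁ : ℝ≥0∞) * starOsc f Q ≤ (C₁ + C₂ : ℝ≥0) * starOsc f Q := by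
      push_cast; gcongr; exact le_self_add
    have hle₂ : (C₂ : ℝ≥0∞) * starOsc f Q ≤ (C₁ + C₂ : ℝ≥0) * starOsc f Q := by
      push_cast; gcongr; exact le_add_self
    by_cases hQ : ∃ N, Q = Cube.top (N + 1)
    · obtain ⟨N, rfl⟩ := hQ
      set Q₀ : Cube n := Cube.top N with hQ₀
      have hpar : Q₀.parent = Cube.top (N + 1) := Cube.parent_top N
      have hlt : (Cube.top (N + 1) : Cube n).1 < Q₀.1 := by
        simp [hQ₀, Cube.top, Cube.containing]
      refine ⟨insert Q₀ {P ∈ 𝒬 | Disjoint P.set Q₀.set}, ?_, ?_, ?_, ?_, ?_, ?_⟩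
      · intro N' hN'
        have : N = N' := by
          have := congrArg Prod.fst hN'
          simp only [Cube.top, Cube.containing] at this
          lia
        exact Or.inl (by rw [hQ₀, this])
      · refine (hd.subset (sep_subset _ _)).insert fun P hP _ => ?_
        exact hP.2.symm
      · rintro P (rfl | hP)
        · exact ⟨hlt, Cube.top_subset_top_succ N⟩
        · exact hsub P hP.1
      · have h2 : volume (⋃ P ∈ insert Q₀ {P ∈ 𝒬 | Disjoint P.set Q₀.set}, P.set) ≤
            volume Q₀.set + volume (⋃ P ∈ 𝒬, P.set) := by
          rw [biUnion_insert]
          refine (measure_union_le _ _).trans (add_le_add le_rfl (measure_mono ?_))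
          exact biUnion_subset_biUnion_left (sep_subset _ _)
        calc _ ≤ 4 * (volume Q₀.set + volume (⋃ P ∈ 𝒬, P.set)) := by gcongr
          _ = 2 * (2 ^ 1 * volume Q₀.set) + 4 * volume (⋃ P ∈ 𝒬, P.set) := by ring
          _ ≤ 2 * (2 ^ n * volume Q₀.set) + volume (Cube.top (N + 1) : Cube n).set := by
            gcongr
            exact one_le_two
          _ = _ := by rw [← Q₀.volume_parent, hpar]; ring
      · filter_upwards [hout] with x hx hxQ hxP
        refine (hx hxQ fun P hP hxP' => ?_).trans hle₁
        -- a stopping cube that meets the child around the origin is contained in it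
        have hk : Q₀.1 ≤ P.1 := by
          have := (hsub P hP).1
          simp only [hQ₀, Cube.top, Cube.containing] at this ⊢
          lia
        by_cases hdis : Disjoint P.set Q₀.set
        · exact hxP P (Or.inr ⟨hP, hdis⟩) hxP'
        · obtain ⟨y, hyP, hy⟩ := not_disjoint_iff.1 hdis
          exact hxP Q₀ (Or.inl rfl) (Cube.subset_of_mem hk hyP hy hxP')
      · rintro P (rfl | hP)
        · filter_upwards [hC₂ f hf Q₀] with x hx hxP
          have := hx hxP
          rw [hpar] at this
          exact this.trans (add_le_add le_rfl hle₂)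
        · filter_upwards [htr P hP.1] with x hx hxP
          exact (hx hxP).trans (add_le_add le_rfl hle₁)
    · refine ⟨𝒬, fun N hN => absurd ⟨N, hN⟩ hQ, hd, hsub, ?_, ?_, fun P hP => ?_⟩
      · refine hvol.trans (le_mul_of_one_le_left zero_le ?_)
        norm_num
      · filter_upwards [hout] with x hx hxQ hxP
        exact (hx hxQ hxP).trans hle₁
      · filter_upwards [htr P hP] with x hx hxP
        exact (hx hxP).trans (add_le_add le_rfl hle₁)
  choose sel hsel using key
  exact ⟨sel, fun N => (hsel _).1 N rfl, fun Q => (hsel Q).2⟩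

/-! ### Trees of stopping cubes -/

section Tree

variable (sel : Cube n → Set (Cube n))

/-- `Descends sel Q P` means that `P` is obtained from `Q` by finitely many stopping steps. -/
def Descends : Cube n → Cube n → Prop := Relation.ReflTransGen fun Q P => P ∈ sel Q

/-- The part of a cube that is not covered by its stopping cubes. -/
def core (Q : Cube n) : Set (E n) := Q.set \ ⋃ P ∈ sel Q, P.set

/-- The union of the cubes obtained from `Q` by exactly `M` stopping steps. -/
def generation : ℕ → Cube n → Set (E n)
  | 0, Q => Q.set
  | M + 1, Q => ⋃ P ∈ sel Q, generation M P

/-- The sum of the weights `w` of all descendants of `Q` that contain `x`. -/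
noncomputable def treeSum (w : Cube n → ℝ≥0∞) (Q : Cube n) (x : E n) : ℝ≥0∞ :=
  ∑' P : Cube n, open Classical in if Descends sel Q P ∧ x ∈ P.set then w P else 0

variable {sel}

theorem measurableSet_core (Q : Cube n) : MeasurableSet (core sel Q) :=
  Q.measurableSet_set.diff (MeasurableSet.biUnion (to_countable _) fun P _ => P.measurableSet_set)

variable (hsub : ∀ Q, ∀ P ∈ sel Q, Q.1 < P.1 ∧ P.set ⊆ Q.set)

include hsub in
theorem Descends.subset {Q P : Cube n} (h : Descends sel Q P) : Q.1 ≤ P.1 ∧ P.set ⊆ Q.set := by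
  induction h with
  | refl => exact ⟨le_rfl, subset_rfl⟩
  | tail _ h ih => exact ⟨ih.1.trans (hsub _ _ h).1.le, (hsub _ _ h).2.trans ih.2⟩

include hsub in
/-- Two descendants of the same cube are comparable or disjoint. -/
theorem Descends.comparable (hd : ∀ Q, (sel Q).PairwiseDisjoint Cube.set) {R Q Q' : Cube n}
    (h : Descends sel R Q) (h' : Descends sel R Q') :
    Descends sel Q Q' ∨ Descends sel Q' Q ∨ Disjoint Q.set Q'.set := by
  induction h using Relation.ReflTransGen.head_induction_on with
  | refl => exact Or.inl h'
  | head hRP hPQ ih =>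
    rename_i R P
    rcases Relation.ReflTransGen.cases_head h' with rfl | ⟨P', hRP', hP'Q'⟩
    · exact Or.inr (Or.inl (Relation.ReflTransGen.head hRP hPQ))
    · by_cases hPP : P = P'
      · subst hPP
        exact ih hP'Q'
      · exact Or.inr (Or.inr ((hd R hRP hRP' hPP).mono (Descends.subset hsub hPQ).2
          (Descends.subset hsub hP'Q').2))

include hsub in
theorem Descends.disjoint_core {Q Q' : Cube n} (h : Descends sel Q Q') (hne : Q ≠ Q') :
    Disjoint (core sel Q) Q'.set := by
  rcases Relation.ReflTransGen.cases_head h with rfl | ⟨P, hP, hPQ⟩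
  · exact absurd rfl hne
  · refine disjoint_left.2 fun x hx hx' => hx.2 ?_
    exact mem_biUnion hP ((Descends.subset hsub hPQ).2 hx')

include hsub in
theorem disjoint_core_of_descends (hd : ∀ Q, (sel Q).PairwiseDisjoint Cube.set) {R Q Q' : Cube n}
    (h : Descends sel R Q) (h' : Descends sel R Q') (hne : Q ≠ Q') :
    Disjoint (core sel Q) (core sel Q') := by
  rcases Descends.comparable hsub hd h h' with h | h | h
  · exact (Descends.disjoint_core hsub h hne).mono_right sdiff_subset
  · exact ((Descends.disjoint_core hsub h hne.symm).mono_right sdiff_subset).symm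
  · exact h.mono sdiff_subset sdiff_subset

theorem volume_le_core (hvol : ∀ Q, 4 * volume (⋃ P ∈ sel Q, P.set) ≤ 3 * volume Q.set)
    (Q : Cube n) : volume Q.set ≤ 4 * volume (core sel Q) := by
  have h1 : volume Q.set ≤ volume (core sel Q) + volume (⋃ P ∈ sel Q, P.set) := by
    refine (measure_mono ?_).trans (measure_union_le _ _)
    rw [core, sdiff_union_self]
    exact subset_union_left
  have h2 : 3 * volume Q.set + volume Q.set ≤ 3 * volume Q.set + 4 * volume (core sel Q) :=
    calc _ = 4 * volume Q.set := by ring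
      _ ≤ 4 * (volume (core sel Q) + volume (⋃ P ∈ sel Q, P.set)) := by gcongr
      _ = 4 * volume (⋃ P ∈ sel Q, P.set) + 4 * volume (core sel Q) := by ring
      _ ≤ _ := add_le_add (hvol Q) le_rfl
  exact (ENNReal.add_le_add_iff_left
    (ENNReal.mul_ne_top (by simp) Q.volume_set_ne_top)).1 h2

theorem volume_generation_le (hd : ∀ Q, (sel Q).PairwiseDisjoint Cube.set)
    (hvol : ∀ Q, 4 * volume (⋃ P ∈ sel Q, P.set) ≤ 3 * volume Q.set) (M : ℕ) (Q : Cube n) :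
    volume (generation sel M Q) ≤ (3 / 4) ^ M * volume Q.set := by
  induction M generalizing Q with
  | zero => simp [generation]
  | succ M ih =>
    have h3 : volume (⋃ P ∈ sel Q, P.set) ≤ 3 / 4 * volume Q.set := by
      have h := hvol Q
      rw [mul_comm, ← ENNReal.le_div_iff_mul_le (by simp) (by simp)] at h
      exact h.trans (le_of_eq (ENNReal.mul_div_right_comm))
    calc _ ≤ ∑' P : sel Q, volume (generation sel M P) :=
          measure_biUnion_le _ (to_countable _) _
      _ ≤ ∑' P : sel Q, (3 / 4) ^ M * volume P.1.set := ENNReal.tsum_le_tsum fun P => ih P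
      _ = (3 / 4) ^ M * volume (⋃ P ∈ sel Q, P.set) := by
          rw [ENNReal.tsum_mul_left, measure_biUnion (to_countable _) (hd Q)
            fun P _ => P.measurableSet_set]
      _ ≤ (3 / 4) ^ M * (3 / 4 * volume Q.set) := by gcongr
      _ = _ := by rw [pow_succ, mul_assoc]

theorem ae_exists_notMem_generation (hd : ∀ Q, (sel Q).PairwiseDisjoint Cube.set)
    (hvol : ∀ Q, 4 * volume (⋃ P ∈ sel Q, P.set) ≤ 3 * volume Q.set) (Q : Cube n) :
    ∀ᵐ x : E n, ∃ M, x ∉ generation sel M Q := by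
  have hlim : Tendsto (fun M : ℕ => (3 / 4 : ℝ≥0∞) ^ M * volume Q.set) atTop (𝓝 0) := by
    have h1 : (3 / 4 : ℝ≥0∞) < 1 := by
      rw [ENNReal.div_lt_iff (by simp) (by simp), one_mul]
      norm_num
    have := ENNReal.Tendsto.mul_const (b := volume Q.set)
      (ENNReal.tendsto_pow_atTop_nhds_zero_of_lt_one h1) (Or.inr Q.volume_set_ne_top)
    rwa [zero_mul] at this
  have h0 : volume (⋂ M, generation sel M Q) = 0 := by
    refine le_antisymm (ge_of_tendsto' hlim fun M => ?_) zero_le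
    exact (measure_mono (iInter_subset _ M)).trans (volume_generation_le hd hvol M Q)
  filter_upwards [compl_mem_ae_iff.2 h0] with x hx
  simpa using hx

include hsub in
theorem add_treeSum_le (w : Cube n → ℝ≥0∞) {P Q : Cube n} (hP : P ∈ sel Q) {x : E n}
    (hx : x ∈ P.set) : w Q + treeSum sel w P x ≤ treeSum sel w Q x := by
  classical
  have e : w Q = ∑' P' : Cube n, if P' = Q then w Q else 0 := by rw [tsum_ite_eq]
  rw [e, treeSum, treeSum, ← ENNReal.tsum_add]
  refine ENNReal.tsum_le_tsum fun P' => ?_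
  have hxQ := (hsub Q P hP).2 hx
  by_cases hPQ : P' = Q
  · subst hPQ
    have h1 : ¬ Descends sel P P' := fun h =>
      absurd (Descends.subset hsub h).1 (not_le.2 (hsub P' P hP).1)
    have h2 : Descends sel P' P' := Relation.ReflTransGen.refl
    simp [h1, h2, hxQ]
  · by_cases hPP : Descends sel P P' ∧ x ∈ P'.set
    · have h2 : Descends sel Q P' := Relation.ReflTransGen.head hP hPP.1
      simp [hPQ, hPP, h2]
    · simp [hPQ, hPP]

theorem le_treeSum (w : Cube n → ℝ≥0∞) {Q : Cube n} {x : E n} (hx : x ∈ Q.set) :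
    w Q ≤ treeSum sel w Q x := by
  classical
  have h2 : Descends sel Q Q := Relation.ReflTransGen.refl
  refine le_trans (le_of_eq ?_) (ENNReal.le_tsum Q)
  simp [h2, hx]

include hsub in
/-- Iterating the one-step estimate down the tree: it terminates at every point that lies in only
finitely many generations. -/
theorem le_mul_treeSum {u : Cube n → E n → ℝ≥0∞} {w : Cube n → ℝ≥0∞} {C : ℝ≥0∞} {x : E n}
    (hout : ∀ Q : Cube n, x ∈ Q.set → (∀ P ∈ sel Q, x ∉ P.set) → u Q x ≤ C * w Q)
    (hin : ∀ Q, ∀ P ∈ sel Q, x ∈ P.set → u Q x ≤ u P x + C * w Q) (M : ℕ) (Q : Cube n)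
    (hx : x ∈ Q.set) (hM : x ∉ generation sel M Q) : u Q x ≤ C * treeSum sel w Q x := by
  induction M generalizing Q with
  | zero => exact absurd hx hM
  | succ M ih =>
    by_cases h : ∃ P ∈ sel Q, x ∈ P.set
    · obtain ⟨P, hP, hxP⟩ := h
      have hM' : x ∉ generation sel M P := fun h => hM (mem_biUnion hP h)
      calc u Q x ≤ u P x + C * w Q := hin Q P hP hxP
        _ ≤ C * treeSum sel w P x + C * w Q := by gcongr; exact ih P hxP hM'
        _ = C * (w Q + treeSum sel w P x) := by ring
        _ ≤ _ := by gcongr; exact add_treeSum_le hsub w hP hxP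
    · push Not at h
      refine (hout Q hx h).trans ?_
      gcongr
      exact le_treeSum w hx

end Tree

/-- Sparse domination on the cubes around the origin, by one family for all of these cubes. -/
theorem exists_sparse_top {T : L2 n →L[ℝ] L2 n} {K : E n → E n → ℝ}
    (hn : 1 ≤ n) (hT : IsCalderonZygmund T K) (h1 : EqInBMO T K (fun _ => 1) (fun _ => 0)) :
    ∃ C : ℝ≥0, ∀ f : E n → ℝ, MemLp f 2 volume → ∃ (𝒮 : Set (Cube n)) (F : Cube n → Set (E n)),
      (∀ Q, MeasurableSet (F Q) ∧ F Q ⊆ Q.set ∧ volume Q.set ≤ 4 * volume (F Q)) ∧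
      𝒮.PairwiseDisjoint F ∧ ∀ N, ∀ᵐ x : E n, x ∈ (Cube.top N : Cube n).set →
        ‖op T (localPart f (Cube.top N)) x‖ₑ ≤
          C * ∑' Q : 𝒮, Q.1.set.indicator (fun _ => starOsc f Q.1) x := by
  obtain ⟨C, hC⟩ := exists_stopping_rule hn hT h1
  refine ⟨C, fun f hf => ?_⟩
  obtain ⟨sel, htop, hsel⟩ := hC f hf
  have hd := fun Q => (hsel Q).1
  have hsub := fun Q => (hsel Q).2.1
  have hvol := fun Q => (hsel Q).2.2.1
  have hmono : ∀ M N, M ≤ N → Descends sel (Cube.top N) (Cube.top M) := by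
    intro M N h
    induction N, h using Nat.le_induction with
    | base => exact Relation.ReflTransGen.refl
    | succ N _ ih => exact Relation.ReflTransGen.head (htop N) ih
  refine ⟨{Q | ∃ N, Descends sel (Cube.top N) Q}, core sel,
    fun Q => ⟨measurableSet_core Q, sdiff_subset, volume_le_core hvol Q⟩, ?_, fun N => ?_⟩
  · rintro Q ⟨N, hN⟩ Q' ⟨N', hN'⟩ hne
    exact disjoint_core_of_descends hsub hd
      ((hmono N (max N N') (le_max_left _ _)).trans hN)
      ((hmono N' (max N N') (le_max_right _ _)).trans hN') hne
  · have a1 : ∀ᵐ x : E n, ∀ Q : Cube n, x ∈ Q.set → (∀ P ∈ sel Q, x ∉ P.set) →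
        ‖op T (localPart f Q) x‖ₑ ≤ C * starOsc f Q := ae_all_iff.2 fun Q => (hsel Q).2.2.2.1
    have a2 : ∀ᵐ x : E n, ∀ Q : Cube n, ∀ P ∈ sel Q, x ∈ P.set →
        ‖op T (localPart f Q) x‖ₑ ≤ ‖op T (localPart f P) x‖ₑ + C * starOsc f Q :=
      ae_all_iff.2 fun Q => (ae_ball_iff (to_countable _)).2 (hsel Q).2.2.2.2
    filter_upwards [a1, a2, ae_exists_notMem_generation hd hvol (Cube.top N)] with x b1 b2 b3 hx
    obtain ⟨M, hM⟩ := b3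
    refine (le_mul_treeSum hsub (u := fun Q x => ‖op T (localPart f Q) x‖ₑ)
      (w := starOsc f) b1 b2 M _ hx hM).trans ?_
    gcongr
    rw [tsum_subtype {Q | ∃ N, Descends sel (Cube.top N) Q}
      fun Q : Cube n => Q.set.indicator (fun _ => starOsc f Q) x]
    refine ENNReal.tsum_le_tsum fun Q => ?_
    split_ifs with h
    · rw [indicator_of_mem (show Q ∈ {Q | ∃ N, Descends sel (Cube.top N) Q} from ⟨N, h.1⟩),
        indicator_of_mem h.2]
    · exact zero_le

/-! ### Exhausting the space -/

theorem Cube.side_top (N : ℕ) : (Cube.top N : Cube n).side = 2 ^ N := by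
  simp [Cube.side, Cube.top, Cube.containing]

theorem Cube.set_subset_star (hn : 1 ≤ n) (Q : Cube n) : Q.set ⊆ Q.star :=
  (Q.set_subset_ball hn).trans (ball_subset_ball (by linarith [Q.radius_pos hn]))

/-- The means of a square integrable function over the cubes around the origin tend to `0`. -/
theorem tendsto_average_top (hn : 1 ≤ n) {f : E n → ℝ} (hf : MemLp f 2 volume) :
    Tendsto (fun N => ‖⨍ y in (Cube.top N : Cube n).star, f y‖ₑ) atTop (𝓝 0) := by
  set V : ℕ → ℝ≥0∞ := fun N => volume (Cube.top N : Cube n).star with hV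
  have hV0 : ∀ N, V N ≠ 0 := fun N => Cube.volume_star_ne_zero hn _
  have hVt : ∀ N, V N ≠ ∞ := fun N => Cube.volume_star_ne_top _
  set v : ℝ≥0∞ := volume (ball (0 : E n) 1) with hv
  have hv0 : v ≠ 0 := (measure_ball_pos _ _ one_pos).ne'
  have hlimV : Tendsto V atTop (𝓝 ∞) := by
    have h1 : ∀ N : ℕ, v * N ≤ V N := by
      intro N
      simp only [hV]
      rw [Cube.volume_star hn, Cube.volume_set, Cube.side_top, mul_comm _ (volume _), mul_assoc]
      refine mul_le_mul' le_rfl ?_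
      have h2 : (N : ℝ) ≤ (2 ^ N) ^ n :=
        calc (N : ℝ) ≤ 2 ^ N := by exact_mod_cast Nat.lt_two_pow_self.le
          _ ≤ _ := le_self_pow₀ (one_le_pow₀ one_le_two) (by lia)
      have h3 : (1 : ℝ≥0∞) ≤ (2 * n) ^ n := by
        refine one_le_pow₀ ?_
        have : (1 : ℝ≥0∞) ≤ n := by exact_mod_cast hn
        exact this.trans (le_mul_of_one_le_left zero_le one_le_two)
      refine le_trans ?_ (le_mul_of_one_le_left zero_le h3)
      rw [← ENNReal.ofReal_natCast]
      exact ENNReal.ofReal_le_ofReal h2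
    have h2 : Tendsto (fun N : ℕ => v * (N : ℝ≥0∞)) atTop (𝓝 (v * ∞)) :=
      ENNReal.Tendsto.const_mul ENNReal.tendsto_nat_nhds_top (Or.inl ENNReal.top_ne_zero)
    rw [ENNReal.mul_top hv0] at h2
    exact tendsto_of_tendsto_of_tendsto_of_le_of_le h2 tendsto_const_nhds h1 fun _ => le_top
  have hlim : Tendsto (fun N => eLpNorm f 2 volume * (V N ^ (1 / 2 : ℝ))⁻¹) atTop (𝓝 0) := by
    have h1 : Tendsto (fun N => (V N ^ (1 / 2 : ℝ))⁻¹) atTop (𝓝 0) := by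
      have h2 := (hlimV.ennrpow_const (1 / 2 : ℝ)).inv
      simpa using h2
    have h3 := ENNReal.Tendsto.const_mul (a := eLpNorm f 2 volume) h1 (Or.inr hf.2.ne)
    rwa [mul_zero] at h3
  refine tendsto_of_tendsto_of_tendsto_of_le_of_le tendsto_const_nhds hlim (fun _ => zero_le)
    fun N => ?_
  have ht0 : V N ^ (1 / 2 : ℝ) ≠ 0 := by simp [hV0]
  have htt : V N ^ (1 / 2 : ℝ) ≠ ∞ := ENNReal.rpow_ne_top_of_nonneg (by norm_num) (hVt N)
  have hsq : V N ^ (1 / 2 : ℝ) * V N ^ (1 / 2 : ℝ) = V N := by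
    rw [← ENNReal.rpow_add _ _ (hV0 N) (hVt N)]; norm_num
  have hH := eLpNorm_le_eLpNorm_mul_rpow_measure_univ (p := 1) (q := 2) one_le_two
    (hf.1.restrict (s := (Cube.top N : Cube n).star))
  rw [eLpNorm_one_eq_lintegral_enorm, Measure.restrict_apply_univ] at hH
  have e : (1 / (1 : ℝ≥0∞).toReal - 1 / (2 : ℝ≥0∞).toReal) = (1 / 2 : ℝ) := by norm_num
  rw [e] at hH
  rw [← ENNReal.mul_le_mul_iff_left (hV0 N) (hVt N)]
  calc _ ≤ ∫⁻ y in (Cube.top N : Cube n).star, ‖f y‖ₑ := enorm_setAverage_mul_le f (hV0 N) (hVt N)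
    _ ≤ eLpNorm f 2 volume * V N ^ (1 / 2 : ℝ) :=
        hH.trans (by gcongr; exact Measure.restrict_le_self)
    _ = eLpNorm f 2 volume * (V N ^ (1 / 2 : ℝ))⁻¹ * V N := by
        set t := V N ^ (1 / 2 : ℝ)
        calc _ = eLpNorm f 2 volume * (t⁻¹ * t) * t := by
              rw [ENNReal.inv_mul_cancel ht0 htt, mul_one]
          _ = eLpNorm f 2 volume * t⁻¹ * (t * t) := by ring
          _ = _ := by rw [hsq]

/-- Sparse domination in terms of the grid with shift `1/3`. -/
theorem exists_sparse_cubes {T : L2 n →L[ℝ] L2 n} {K : E n → E n → ℝ}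
    (hn : 1 ≤ n) (hT : IsCalderonZygmund T K) (h1 : EqInBMO T K (fun _ => 1) (fun _ => 0)) :
    ∃ C : ℝ≥0, ∀ f : E n → ℝ, MemLp f 2 volume → ∃ (𝒮 : Set (Cube n)) (F : Cube n → Set (E n)),
      (∀ Q, MeasurableSet (F Q) ∧ F Q ⊆ Q.set ∧ volume Q.set ≤ 4 * volume (F Q)) ∧
      𝒮.PairwiseDisjoint F ∧ ∀ᵐ x : E n, ‖op T f x‖ₑ ≤
          C * ∑' Q : 𝒮, Q.1.set.indicator (fun _ => starOsc f Q.1) x := by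
  obtain ⟨C, hC⟩ := exists_sparse_top hn hT h1
  obtain ⟨C₁, hC₁⟩ := exists_forall_enorm_op_indicator_ball_le hn hT h1
  refine ⟨C, fun f hf => ?_⟩
  obtain ⟨𝒮, F, hF, hdisj, hdom⟩ := hC f hf
  refine ⟨𝒮, F, hF, hdisj, ?_⟩
  set S : ℕ → Set (E n) := fun N => (Cube.top N : Cube n).star with hS
  have hSm : ∀ N, MeasurableSet (S N) := fun N => Cube.measurableSet_star _
  have hev : ∀ x : E n, ∀ᶠ N in atTop, x ∈ (Cube.top N : Cube n).set := by
    intro x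
    obtain ⟨N, hN⟩ := Cube.exists_mem_top x
    filter_upwards [eventually_ge_atTop N] with M hM
    exact Cube.monotone_top hM hN
  obtain ⟨ns, hns, hlim⟩ := exists_subseq_op_tendsto T hf (u := fun N => (S N).indicator f)
    (fun N => hf.1.indicator (hSm N))
    (fun N => Eventually.of_forall fun x => enorm_indicator_le_enorm_self _ _)
    (Eventually.of_forall fun x => tendsto_const_nhds.congr' <| by
      filter_upwards [hev x] with N hN
      rw [indicator_of_mem (Cube.set_subset_star hn _ hN)])
  set c : ℕ → ℝ := fun N => ⨍ y in S N, f y with hc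
  have hmi : ∀ N, MemLp ((S N).indicator fun _ => (1 : ℝ)) 2 volume := fun N =>
    memLp_indicator_const 2 (hSm N) 1 (Or.inr (Cube.volume_star_ne_top _))
  have hdec : ∀ N, (S N).indicator f =
      localPart f (Cube.top N) + c N • (S N).indicator fun _ => (1 : ℝ) := by
    intro N
    funext x
    by_cases hx : x ∈ S N
    · have hx' : x ∈ (Cube.top N : Cube n).star := hx
      simp [hx', localPart, hc, hS]
    · have hx' : x ∉ (Cube.top N : Cube n).star := hx
      simp [hx, hx', localPart]
  have a1 : ∀ᵐ x : E n, ∀ N, op T ((S N).indicator f) x =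
      op T (localPart f (Cube.top N)) x + c N * op T ((S N).indicator fun _ => 1) x := by
    refine ae_all_iff.2 fun N => ?_
    rw [hdec N]
    filter_upwards [op_add T (memLp_localPart hf (Cube.top N)) ((hmi N).const_smul (c N)),
      op_smul T (c N) (hmi N)] with x e1 e2
    rw [e1, Pi.add_apply, e2, Pi.smul_apply, smul_eq_mul]
  have a2 : ∀ᵐ x : E n, ∀ N, x ∈ (Cube.top N : Cube n).set →
      ‖op T ((S N).indicator fun _ => 1) x‖ₑ ≤ C₁ := by
    refine ae_all_iff.2 fun N => ?_
    filter_upwards [hC₁ (Cube.top N : Cube n).center _ (Cube.radius_pos hn _)] with x hx hxN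
    exact hx (Cube.set_subset_ball hn _ hxN)
  filter_upwards [hlim, a1, a2, ae_all_iff.2 hdom] with x b1 b2 b3 b4
  set Z := (C : ℝ≥0∞) * ∑' Q : 𝒮, Q.1.set.indicator (fun _ => starOsc f Q.1) x
  have h0 : Tendsto (fun j => Z + ‖c (ns j)‖ₑ * C₁) atTop (𝓝 (Z + 0 * C₁)) :=
    (ENNReal.Tendsto.mul_const ((tendsto_average_top hn hf).comp hns.tendsto_atTop)
      (Or.inr (by simp))).const_add Z
  rw [zero_mul, add_zero] at h0
  refine le_of_tendsto_of_tendsto b1.enorm h0 ?_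
  filter_upwards [hns.tendsto_atTop.eventually (hev x)] with j hj
  rw [b2]
  refine (enorm_add_le _ _).trans (add_le_add (b4 _ hj) ?_)
  rw [enorm_mul]
  gcongr
  exact b3 _ hj

/-! ### Passing to the cubes of the shifted grids -/

/-- Mean oscillation is controlled by the mean oscillation on a larger set. -/
theorem starOsc_mul_le_osc (hn : 1 ≤ n) {f : E n → ℝ} {Q : Cube n} {R : Set (E n)}
    (hf : MemLp f 2 volume) (hRt : volume R ≠ ∞) (hQR : Q.star ⊆ R) :
    starOsc f Q * volume Q.star ≤ 2 * (ENNReal.ofReal (osc R f) * volume R) := by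
  have hQ0 := Q.volume_star_ne_zero hn
  have hQt := Q.volume_star_ne_top
  have hR0 : volume R ≠ 0 := fun h => hQ0 (measure_mono_null hQR h)
  have : IsFiniteMeasure (volume.restrict R) := ⟨by simpa using hRt.lt_top⟩
  have := Q.isFiniteMeasure_restrict_star
  set a := ⨍ y in R, f y with ha
  set c := ⨍ y in Q.star, f y with hc
  have hint : Integrable (fun x => f x - a) (volume.restrict R) :=
    ((hf.restrict R).integrable one_le_two).sub (integrable_const _)
  have hosc : ENNReal.ofReal (osc R f) * volume R = ∫⁻ y in R, ‖f y - a‖ₑ := by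
    rw [osc, ofReal_setAverage hint.abs (Eventually.of_forall fun _ => abs_nonneg _),
      ENNReal.div_mul_cancel hR0 hRt]
    simp only [Real.enorm_eq_ofReal_abs, ha]
  rw [hosc, ← lintegral_localPart hn]
  have hca : ‖a - c‖ₑ * volume Q.star ≤ ∫⁻ y in Q.star, ‖f y - a‖ₑ := by
    have e : c - a = ⨍ y in Q.star, (f y - a) := by
      rw [setAverage_eq, integral_sub (integrableOn_star hf Q) (integrable_const _), smul_sub,
        ← setAverage_eq, ← setAverage_eq, setAverage_const hQ0 hQt]
    rw [← enorm_neg, neg_sub, e]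
    exact enorm_setAverage_mul_le _ hQ0 hQt
  calc _ = ∫⁻ x in Q.star, ‖f x - c‖ₑ := by
        simp only [localPart, enorm_indicator_eq_indicator_enorm, ← hc]
        exact lintegral_indicator Q.measurableSet_star _
    _ ≤ ∫⁻ x in Q.star, (‖f x - a‖ₑ + ‖a - c‖ₑ) := by
        refine lintegral_mono fun x => ?_
        have e : f x - c = (f x - a) + (a - c) := by ring
        simp only [e]
        exact enorm_add_le _ _
    _ = (∫⁻ x in Q.star, ‖f x - a‖ₑ) + ‖a - c‖ₑ * volume Q.star := by
        rw [lintegral_add_right _ measurable_const]; simp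
    _ ≤ 2 * ∫⁻ x in Q.star, ‖f x - a‖ₑ := by rw [two_mul]; gcongr
    _ ≤ _ := by gcongr

/-- A dyadic cube of one of the shifted grids, of comparable size, contains `Q.star`. -/
theorem exists_dyadicCube_star_subset (hn : 1 ≤ n) (Q : Cube n) :
    ∃ R ∈ dyadicCubes n, Q.star ⊆ R ∧
      volume R = 2 ^ (12 * n * n) * volume Q.set := by
  have hside : (2 : ℝ) ^ (-(Q.1 - (12 * n : ℕ))) = 2 ^ (12 * n) * Q.side := by
    rw [neg_sub, sub_eq_add_neg, zpow_add₀ two_ne_zero, zpow_natCast, Cube.side]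
  have hr := Q.radius_pos hn
  have hs := Q.side_pos
  have hlt : 2 * (2 * (n * Q.side)) < (2 : ℝ) ^ (-(Q.1 - (12 * n : ℕ))) / 3 := by
    have h2 : (12 * n : ℝ) < 2 ^ (12 * n) := by exact_mod_cast Nat.lt_two_pow_self
    rw [hside]
    nlinarith
  obtain ⟨α, hα, m, hm⟩ := exists_closedBall_subset_dyadicCube Q.center (by positivity) hlt
  refine ⟨_, ⟨α, hα, _, m, rfl⟩, ball_subset_closedBall.trans hm, ?_⟩
  rw [volume_dyadicCube, hside, Cube.volume_set, mul_pow, ENNReal.ofReal_mul (by positivity),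
    ← pow_mul, ENNReal.ofReal_pow zero_le_two, ENNReal.ofReal_ofNat]

theorem Cube.fst_eq_of_volume_eq (hn : 1 ≤ n) {P Q : Cube n} (h : volume P.set = volume Q.set) :
    P.1 = Q.1 := by
  have hP := P.side_pos
  have hQ := Q.side_pos
  rw [Cube.volume_set, Cube.volume_set, ENNReal.ofReal_eq_ofReal_iff (by positivity)
    (by positivity), pow_left_inj₀ hP.le hQ.le (by lia)] at h
  have := zpow_right_injective₀ (a := (2 : ℝ)) two_pos (by norm_num) h
  lia

end SparseOsc

open SparseOsc in
theorem proposition4p1 (n : ℕ) (hn : 1 ≤ n) :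
    ∃ η : ℝ, 0 < η ∧ η < 1 ∧
      ∀ (T : SparseOsc.L2 n →L[ℝ] SparseOsc.L2 n) (K : SparseOsc.E n → SparseOsc.E n → ℝ),
        SparseOsc.IsCalderonZygmund T K →
        SparseOsc.EqInBMO T K (fun _ => 1) (fun _ => 0) →
        ∃ C : ℝ≥0, ∀ f : SparseOsc.L2 n,
          ∃ S : Set (Set (SparseOsc.E n)), SparseOsc.IsSparse η S ∧
            ∀ᵐ x : SparseOsc.E n, ‖T f x‖ₑ ≤ (C : ℝ≥0∞) * SparseOsc.sparseOscSum S f x := by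
  set A : ℝ≥0∞ := 2 ^ (12 * n * n) with hA
  have hA0 : A ≠ 0 := by simp [hA]
  have hAt : A ≠ ∞ := by simp [hA]
  have hη0 : (0 : ℝ) < 4 * 2 ^ (12 * n * n) := by positivity
  refine ⟨(4 * 2 ^ (12 * n * n))⁻¹, by positivity, inv_lt_one_of_one_lt₀ ?_, fun T K hT h1 => ?_⟩
  · have : (1 : ℝ) ≤ 2 ^ (12 * n * n) := one_le_pow₀ one_le_two
    linarith
  obtain ⟨C, hC⟩ := exists_sparse_cubes hn hT h1
  choose R hRdy hRstar hRvol using exists_dyadicCube_star_subset (n := n) hn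
  set v : ℝ≥0∞ := volume (Metric.ball (0 : E n) 1)
  have hv : v ≠ ∞ := measure_ball_lt_top.ne
  have hv0 : v ≠ 0 := (Metric.measure_ball_pos _ _ one_pos).ne'
  set β : ℝ≥0∞ := (2 * n) ^ n * v with hβ
  have hβ0 : β ≠ 0 := by
    have : n ≠ 0 := by lia
    simp [hβ, hv0, this]
  have hβt : β ≠ ∞ := ENNReal.mul_ne_top
    (ENNReal.pow_ne_top (ENNReal.mul_ne_top (by simp) (by simp))) hv
  set B : ℝ≥0∞ := 2 * A * β⁻¹ with hB
  have hBt : B ≠ ∞ := ENNReal.mul_ne_top (ENNReal.mul_ne_top (by simp) hAt)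
    (ENNReal.inv_ne_top.2 hβ0)
  refine ⟨C * B.toNNReal, fun f => ?_⟩
  have hf : MemLp f 2 volume := Lp.memLp f
  obtain ⟨𝒮, F, hF, hdisj, hdom⟩ := hC f hf
  have hRt : ∀ Q, volume (R Q) ≠ ∞ := fun Q => by
    rw [hRvol]; exact ENNReal.mul_ne_top hAt Q.volume_set_ne_top
  have hosc : ∀ Q, starOsc f Q ≤ B * ENNReal.ofReal (osc (R Q) f) := by
    intro Q
    rw [← ENNReal.mul_le_mul_iff_left (Q.volume_star_ne_zero hn) Q.volume_star_ne_top]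
    refine (starOsc_mul_le_osc hn hf (hRt Q) (hRstar Q)).trans (le_of_eq ?_)
    rw [hRvol, Cube.volume_star hn, hB]
    calc _ = 2 * A * (β⁻¹ * β) * ENNReal.ofReal (osc (R Q) f) * volume Q.set := by
          rw [ENNReal.inv_mul_cancel hβ0 hβt]; ring
      _ = _ := by rw [hβ]; ring
  have hsub : ∀ Q : Cube n, Q.set ⊆ R Q := fun Q => (Cube.set_subset_star hn Q).trans (hRstar Q)
  -- each cube `S` of the family remembers one cube of the grid that it was built from
  set q : Set (E n) → Cube n := Function.invFunOn R 𝒮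
  have hq : ∀ S ∈ R '' 𝒮, q S ∈ 𝒮 ∧ R (q S) = S := fun S hS =>
    ⟨Function.invFunOn_mem hS, Function.invFunOn_eq hS⟩
  refine ⟨R '' 𝒮, ⟨?_, fun S => F (q S), fun S hS => ?_, fun S hS S' hS' hne => ?_⟩, ?_⟩
  · rintro _ ⟨Q, _, rfl⟩
    exact hRdy Q
  · obtain ⟨_, h2⟩ := hq S hS
    obtain ⟨f1, f2, f3⟩ := hF (q S)
    refine ⟨f1, (f2.trans (hsub _)).trans h2.subset, ?_⟩
    conv_lhs => rw [← h2]
    rw [hRvol, ENNReal.ofReal_inv_of_pos hη0, ENNReal.ofReal_mul (by norm_num),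
      ENNReal.ofReal_pow zero_le_two, ENNReal.ofReal_ofNat, ENNReal.ofReal_ofNat, ← hA,
      ENNReal.inv_mul_le_iff (mul_ne_zero (by simp) hA0) (ENNReal.mul_ne_top (by simp) hAt)]
    calc _ ≤ A * (4 * volume (F (q S))) := by gcongr
      _ = _ := by ring
  · refine hdisj (hq S hS).1 (hq S' hS').1 fun h => hne ?_
    rw [← (hq S hS).2, ← (hq S' hS').2, h]
  · rw [op_coe] at hdom
    filter_upwards [hdom] with x hx
    refine hx.trans ?_
    rw [ENNReal.coe_mul, ENNReal.coe_toNNReal hBt, mul_assoc]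
    gcongr
    rw [sparseOscSum, ← ENNReal.tsum_mul_left]
    -- a cube of the grid is determined by a point in it and its size
    set 𝒮x : Set (Cube n) := {Q ∈ 𝒮 | x ∈ Q.set}
    set φ : 𝒮x → R '' 𝒮 := fun Q => ⟨R Q, Set.mem_image_of_mem R Q.2.1⟩
    have hφ : Function.Injective φ := by
      intro Q Q' h
      have hR : R Q.1 = R Q'.1 := congrArg Subtype.val h
      have hvol := hRvol Q.1
      rw [hR, hRvol, ENNReal.mul_right_inj hA0 hAt] at hvol
      exact Subtype.ext (Cube.eq_of_mem (Cube.fst_eq_of_volume_eq hn hvol) Q.2.2 Q'.2.2)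
    calc ∑' Q : 𝒮, Q.1.set.indicator (fun _ => starOsc f Q.1) x
        = ∑' Q : 𝒮x, starOsc f Q.1 := by
          rw [tsum_subtype 𝒮 fun Q : Cube n => Q.set.indicator (fun _ => starOsc f Q) x,
            tsum_subtype 𝒮x fun Q : Cube n => starOsc f Q]
          refine tsum_congr fun Q => ?_
          by_cases h1 : Q ∈ 𝒮 <;> by_cases h2 : x ∈ Q.set <;> simp [h1, h2, 𝒮x]
      _ ≤ ∑' Q : 𝒮x, B * (φ Q).1.indicator (fun _ => ENNReal.ofReal (osc (φ Q).1 f)) x := by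
          refine ENNReal.tsum_le_tsum fun Q => ?_
          rw [Set.indicator_of_mem (hsub Q.1 Q.2.2)]
          exact hosc Q.1
      _ ≤ _ := ENNReal.tsum_comp_le_tsum_of_injective hφ
          fun S : R '' 𝒮 => B * S.1.indicator (fun _ => ENNReal.ofReal (osc S.1 f)) x
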